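/- **Setting.** Let $(M,\rho,\mu)$ be a locally compact separable metric space with a non-zero Borel measure $\mu$, finite on compact sets, that is doubling: there is $K<\infty$ with $\mu(B(x,2r))\le K\mu(B(x,r))$ for all open balls. Let $d\ge1$ be an integer. For an exponent $r$, $r'$ denotes the Hölder conjugate ($1'=\infty$, $\infty'=1$); $|\cdot|$ is the Euclidean norm of vectors and the spectral norm of matrices. *Dyadic systems.* Let $0<c_0\le C_0<\infty$ and $\delta\in(0,1)$ with $12C_0\delta\le c_0$. A dyadic system $\mathcal D$ with these parameters consists, for each $k\in\mathbb Z$, of countably many open sets ("cubes") $Q^k_i$ and points $z^k_i$ such that: (1) if $l\ge k$, then either $Q^l_i\subseteq Q^k_j$ or $Q^l_i\cap Q^k_j=\emptyset$; (2) for each $k$ the sets $Q_i^k$ are pairwise disjoint and cover $M$ up to a $\mu$-null set; (3) $B(z^k_i,\frac{c_0}{3}\delta^k)\subseteq Q^k_i\subseteq B(z^k_i,2C_0\delta^k)$; (4) if $l\ge k$ and $Q^l_i\subseteq Q^k_j$, then $B(z^l_i,2C_0\delta^l)\subseteq B(z^k_j,2C_0\delta^k)$. A cube is understood together with its generation $k$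 and index $i$. For a cube $P=Q^k_i$ and $\lambda>1$ put $\lambda P=\{x\in M: \rho(x,P)\le 2C_0(\lambda-1)\delta^k\}$. For $\varepsilon\in(0,1)$, a family $\mathcal S$ of cubes is $\varepsilon$-sparse if its members have positive finite measure and there are pairwise disjoint measurable sets $F_P\subseteq P$ ($P\in\mathcal S$) with $\mu(F_P)\ge\varepsilon\mu(P)$. *Matrix weights.* A $d\times d$ matrix weight on $M$ is a measurable function $W:M\to M_d(\mathbb C)$, positive definite $\mu$-a.e., with $\int_E|W|\,d\mu<\infty$ for all bounded Borel sets $E$. For $1<r<\infty$ let $L^r_W(M,\mu)$ consist of the measurable $f:M\to\mathbb C^d$ with $\|f\|_{L^r_W(M,\mu)}=\big(\int_M|W(x)^{1/r}f(x)|^r\,d\mu(x)\big)^{1/r}<\infty$; this is used for any measurable, a.e. positive definite $W$. For $1<u\le v<\infty$ let $$[W]_{A_{u,v}}=\sup_B \frac1{\mu(B)}\int_B\Big(\frac1{\mu(B)}\int_B|W(x)^{1/v}W(y)^{-1/v}|^{u'}\,d\mu(y)\Big)^{v/u'}d\mu(x),$$ the supremum being over all open balls $B\subseteq M$. *Convex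 body averages.* For $1\le r<\infty$, a Borel set $Q$ with $0<\mu(Q)<\infty$ and $f\in L^r(Q,\mu;\mathbb C^d)$, put $$\langle\!\langle f\rangle\!\rangle_{\mathscr L^r(Q)}=\Big\{\frac1{\mu(Q)}\int_Q\varphi f\,d\mu:\ \varphi \text{ scalar},\ \|\varphi\|_{L^{r'}(Q,\mu/\mu(Q))}\le1\Big\}\subseteq\mathbb C^d,$$ and for $A,B\subseteq\mathbb C^d$ put $|A\cdot B|=\sup\{|\sum_i u_i\overline{v_i}|: u\in A,\ v\in B\}$. **Theorem.** Let $1\le p_0<q_0\le\infty$ and $p\in(p_0,q_0)$, and set $$t=\frac p{p_0},\quad s=\frac{q_0}p,\quad a=\frac p{t-1},\quad b=s'p,\quad \alpha=\frac1{s'(p-p_0)}+\frac1{p'}.$$ There is a constant $C>0$ depending only on $(M,\rho,\mu)$, the dimension $d$, $p_0$, $q_0$ and $p$ such that the following holds. Let $\mathcal D$ be a dyadic system in $M$, $\lambda\ge2$, $0<\varepsilon<1$, $\mathcal S\subseteq\mathcal D$ an $\varepsilon$-sparse family, and $W$ a $d\times d$ matrix weight on $M$ with $[W^{s'}]_{A_{a',b}}<\infty$;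 put $W'=W^{-1/(p-1)}$. Then for all $f\in L^p_W(M,\mu)$ and $g\in L^{p'}_{W'}(M,\mu)$ one has $f\in L^{p_0}(\lambda P,\mu;\mathbb C^d)$ and $g\in L^{q_0'}(\lambda P,\mu;\mathbb C^d)$ for every $P\in\mathcal S$, and $$\sum_{P\in\mathcal S}\mu(P)\,\big|\langle\!\langle f\rangle\!\rangle_{\mathscr L^{p_0}(\lambda P)}\cdot\langle\!\langle g\rangle\!\rangle_{\mathscr L^{q_0'}(\lambda P)}\big|\le\frac C\varepsilon\,[W^{s'}]_{A_{a',b}}^{\alpha}\,\|f\|_{L^p_W(M,\mu)}\,\|g\|_{L^{p'}_{W'}(M,\mu)}.$$ -/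

import Mathlib

open MeasureTheory Function
open scoped ENNReal NNReal ComplexOrder

noncomputable section

/-- Volume doubling for open balls, with a finite constant. -/
def VolumeDoubling {M : Type*} [MetricSpace M] [MeasurableSpace M] (μ : Measure M) : Prop :=
  ∃ K : ℝ≥0, ∀ (x : M) (r : ℝ), 0 < r →
    μ (Metric.ball x (2 * r)) ≤ (K : ℝ≥0∞) * μ (Metric.ball x r)

/-- A dyadic system with parameters `c₀`, `C₀`, `δ`: for every generation `k` a countable family
of open cubes `cube k i`, with centres `center k i`. A cube is an index `(k, i)`, so that it knows
its generation. -/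
structure DyadicSystem {M : Type*} [MetricSpace M] [MeasurableSpace M] (μ : Measure M) where
  c₀ : ℝ
  C₀ : ℝ
  δ : ℝ
  c₀_pos : 0 < c₀
  c₀_le : c₀ ≤ C₀
  δ_pos : 0 < δ
  δ_lt_one : δ < 1
  param_le : 12 * C₀ * δ ≤ c₀
  ι : ℤ → Type
  countable_ι : ∀ k, Countable (ι k)
  cube : ∀ k, ι k → Set M
  center : ∀ k, ι k → M
  isOpen_cube : ∀ k i, IsOpen (cube k i)
  nested : ∀ k l, k ≤ l → ∀ (i : ι l) (j : ι k),
    cube l i ⊆ cube k j ∨ Disjoint (cube l i) (cube k j)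
  disjoint_cube : ∀ k, Pairwise (Disjoint on cube k)
  covering : ∀ k, μ (⋃ i, cube k i)ᶜ = 0
  inner_ball : ∀ k i, Metric.ball (center k i) (c₀ / 3 * δ ^ k) ⊆ cube k i
  outer_ball : ∀ k i, cube k i ⊆ Metric.ball (center k i) (2 * C₀ * δ ^ k)
  ball_subset_ball : ∀ k l, k ≤ l → ∀ (i : ι l) (j : ι k), cube l i ⊆ cube k j →
    Metric.ball (center l i) (2 * C₀ * δ ^ l) ⊆ Metric.ball (center k j) (2 * C₀ * δ ^ k)

namespace DyadicSystem

variable {M : Type*} [MetricSpace M] [MeasurableSpace M] {μ : Measure M}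

/-- The cubes of the system, of all generations. -/
abbrev Cube (D : DyadicSystem μ) : Type := Σ k, D.ι k

/-- The set of points of a cube. -/
def toSet (D : DyadicSystem μ) (P : D.Cube) : Set M := D.cube P.1 P.2

/-- `ℓ(P) = 2 C₀ δ ^ k` for a cube of generation `k`. -/
def ell (D : DyadicSystem μ) (P : D.Cube) : ℝ := 2 * D.C₀ * D.δ ^ P.1

/-- The neighbourhood `lam P = {x | d(x, P) ≤ (lam - 1) ℓ(P)}`. -/
def dilate (D : DyadicSystem μ) (lam : ℝ) (P : D.Cube) : Set M :=
  {x | Metric.infDist x (D.toSet P) ≤ (lam - 1) * D.ell P}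

end DyadicSystem

/-- `ε`-sparseness of a family of sets of positive finite measure. -/
def IsSparse {M J : Type*} [MeasurableSpace M] (μ : Measure M) (ε : ℝ) (Q : J → Set M) : Prop :=
  (∀ j, MeasurableSet (Q j) ∧ 0 < μ (Q j) ∧ μ (Q j) < ∞) ∧
  ∃ F : J → Set M, (∀ j, MeasurableSet (F j)) ∧ (∀ j, F j ⊆ Q j) ∧
    Pairwise (Disjoint on F) ∧ ∀ j, ENNReal.ofReal ε * μ (Q j) ≤ μ (F j)

/-- The power `A ^ r` of a positive definite matrix, by the functional calculus. -/
def matPow {d : ℕ} (A : Matrix (Fin d) (Fin d) ℂ) (r : ℝ) : Matrix (Fin d) (Fin d) ℂ :=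
  cfc (fun x : ℝ => x ^ r) A

/-- The action of a matrix on `ℂ^d` with the Euclidean norm; its operator norm is the spectral
norm of the matrix. -/
def matOp {d : ℕ} (A : Matrix (Fin d) (Fin d) ℂ) :
    EuclideanSpace ℂ (Fin d) →L[ℂ] EuclideanSpace ℂ (Fin d) :=
  Matrix.toEuclideanCLM (n := Fin d) (𝕜 := ℂ) A

section Weights

variable {M : Type*} [MetricSpace M] [MeasurableSpace M] {d : ℕ}

/-- A matrix weight: measurable, positive definite almost everywhere, integrable over bounded
Borel sets. -/
structure IsMatrixWeight (μ : Measure M) (W : M → Matrix (Fin d) (Fin d) ℂ) : Prop where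
  aemeasurable : ∀ i j, AEMeasurable (fun x => W x i j) μ
  posDef : ∀ᵐ x ∂μ, (W x).PosDef
  lintegral_lt : ∀ E : Set M, MeasurableSet E → Bornology.IsBounded E →
    ∫⁻ x in E, ‖matOp (W x)‖ₑ ∂μ < ∞

/-- The norm `‖f‖_{L^p_W} = (∫ |W^{1/p} f|^p)^{1/p}`, with values in `[0, ∞]`. -/
def weightedNorm (μ : Measure M) (p : ℝ) (W : M → Matrix (Fin d) (Fin d) ℂ)
    (f : M → EuclideanSpace ℂ (Fin d)) : ℝ≥0∞ :=
  (∫⁻ x, ‖matOp (matPow (W x) (1 / p)) (f x)‖ₑ ^ p ∂μ) ^ (1 / p)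

/-- Membership in `L^p_W`. -/
def MemWeightedLp (μ : Measure M) (p : ℝ) (W : M → Matrix (Fin d) (Fin d) ℂ)
    (f : M → EuclideanSpace ℂ (Fin d)) : Prop :=
  AEStronglyMeasurable f μ ∧ weightedNorm μ p W f < ∞

/-- The two-exponent Muckenhoupt characteristic `[W]_{A_{p,q}}`: the supremum over open balls `B`
of `⨍_B (⨍_B |W(x)^{1/q} W(y)^{-1/q}|^{p'} dμ(y))^{q/p'} dμ(x)`, where `p' = p / (p - 1)`. -/
def muckenhoupt (μ : Measure M) (p q : ℝ) (W : M → Matrix (Fin d) (Fin d) ℂ) : ℝ≥0∞ :=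
  ⨆ (z : M) (r : ℝ) (_ : 0 < r),
    ⨍⁻ x in Metric.ball z r,
      (⨍⁻ y in Metric.ball z r,
        ‖matOp (matPow (W x) (1 / q) * matPow (W y) (-(1 / q)))‖ₑ ^ p.conjExponent ∂μ)
          ^ (q / p.conjExponent) ∂μ

end Weights

/-- The convex body average of `f` in `L^r(Q)` with the normalised measure `μ / μ(Q)`: the set of
all averages `⨍_Q φ f dμ` with `φ` in the unit ball of `L^{r'}(Q)`. -/
def convexBodyAverage {M : Type*} [MeasurableSpace M] {d : ℕ} (μ : Measure M) (r : ℝ≥0∞)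
    (Q : Set M) (f : M → EuclideanSpace ℂ (Fin d)) : Set (EuclideanSpace ℂ (Fin d)) :=
  {v | ∃ φ : M → ℂ, MemLp φ r.conjExponent ((μ Q)⁻¹ • μ.restrict Q) ∧
    eLpNorm φ r.conjExponent ((μ Q)⁻¹ • μ.restrict Q) ≤ 1 ∧
    v = ∫ x, φ x • f x ∂((μ Q)⁻¹ • μ.restrict Q)}

/-- The Minkowski product `{u · v | u ∈ A, v ∈ B}`, where `u · v = ∑ u_i conj(v_i)`. -/
def minkowskiDot {d : ℕ} (A B : Set (EuclideanSpace ℂ (Fin d))) : Set ℂ :=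
  {z | ∃ u ∈ A, ∃ v ∈ B, z = inner ℂ v u}

/-- `|A| = sup {|z| : z ∈ A}`, with values in `[0, ∞]`. -/
def supAbs (A : Set ℂ) : ℝ≥0∞ := ⨆ z ∈ A, ‖z‖ₑ

end

noncomputable section

open Metric Set

/-! Put V = W^{1/p}, U = W^{-1/p}, and let N be the characteristic. Since (W^{s'})^{1/b} = W^{1/p}
and a'' = a, the hypothesis says that ⨍_B (⨍_B |V(x)U(y)|^a dy)^{b/a} dx ≤ N on every ball B. The
two norms on the right become the L^p norm of |Vf| and the L^{p'} norm of |Ug|, and the exponents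
satisfy 1/p₀ = 1/a + 1/p and 1/q₀' = 1/b + 1/p'.

For a fixed vector e ≠ 0 the scalar functions |Ve|^b and |Ue|^a satisfy scalar Muckenhoupt
conditions with constants N and N^{a/b}. The sharp reverse Hölder inequality `reverse_holder`
therefore improves their integrability by factors 1 + η with η of order 1/N and N^{-a/b}
respectively.

Each dilated cube is comparable to a ball B. `exists_reducing_basis` gives on 2B an Auerbach basis
e_i for the norm e ↦ (⨍|Ve|^b)^{1/b}, whose dual basis e'_i satisfies (⨍|Ue'_i|^a)^{1/a} ≤ d
N^{1/b}. Expanding ⟨v,u⟩ = Σ ⟨e'_i,u⟩⟨v,e_i⟩ and applying Hölder with the improved exponents bounds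
the product of the two convex bodies by N^{1/b} times an L^σ average of |Vf| and an L^τ average of
|Ug|, where σ < p and τ < p' strictly (`supAbs_minkowskiDot_le`).

Sparseness turns the sum of these products into the integral of two maximal functions. By
`lintegral_maximal_rpow_le` they cost (1/η)^{1/p} and (1/η')^{1/p'} up to constants, that is
N^{a/(bp)} and N^{1/p'}. The total power 1/b + a/(bp) + 1/p' equals α. -/

/-- A doubling measure with doubling constant `K`, positive and finite on balls. -/
structure DoublingWith {M : Type*} [MetricSpace M] [MeasurableSpace M] (μ : Measure M)
    (K : ℝ≥0) : Prop where
  one_le : 1 ≤ K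
  doubling : ∀ (x : M) (r : ℝ), 0 < r → μ (ball x (2 * r)) ≤ (K : ℝ≥0∞) * μ (ball x r)
  pos : ∀ (x : M) (r : ℝ), 0 < r → 0 < μ (ball x r)
  lt_top : ∀ (x : M) (r : ℝ), μ (ball x r) < ∞

/-! ### Doubling measures and Vitali coverings. -/

section Doubling

variable {M : Type*} [MetricSpace M] [MeasurableSpace M] {μ : Measure M} {K : ℝ≥0}

lemma measure_ball_two_pow_mul_le
    (h : ∀ (x : M) (r : ℝ), 0 < r → μ (ball x (2 * r)) ≤ (K : ℝ≥0∞) * μ (ball x r))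
    (x : M) {r : ℝ} (hr : 0 < r) (n : ℕ) :
    μ (ball x (2 ^ n * r)) ≤ (K : ℝ≥0∞) ^ n * μ (ball x r) := by
  induction n with
  | zero => simp
  | succ n ih =>
    have := h x (2 ^ n * r) (by positivity)
    rw [← mul_assoc, ← pow_succ'] at this
    refine this.trans ?_
    rw [pow_succ', mul_assoc]
    gcongr

/-- Doubling spreads information from one ball to all larger ones. A null ball would make the whole
space null, and every point has a small ball of finite measure, so every ball has finite measure. -/
lemma VolumeDoubling.exists_doublingWith [LocallyCompactSpace M]
    [BorelSpace M] [IsFiniteMeasureOnCompacts μ] (hd : VolumeDoubling μ) (hμ : μ ≠ 0) :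
    ∃ K, DoublingWith μ K := by
  obtain ⟨K, hK⟩ := hd
  have key := fun x r hr n => measure_ball_two_pow_mul_le hK x (r := r) hr n
  have large : ∀ (r s : ℝ), 0 < r → ∃ n : ℕ, s ≤ 2 ^ n * r := by
    intro r s hr
    obtain ⟨n, hn⟩ := pow_unbounded_of_one_lt (s / r) (one_lt_two)
    exact ⟨n, by rw [div_lt_iff₀ hr] at hn; exact hn.le⟩
  have hpos : ∀ (x : M) (r : ℝ), 0 < r → 0 < μ (ball x r) := by
    intro x r hr
    by_contra h0
    have h0 : μ (ball x r) = 0 := by simpa using h0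
    apply hμ
    rw [← Measure.measure_univ_eq_zero, ← iUnion_ball_nat x]
    refine measure_iUnion_null fun m => ?_
    obtain ⟨n, hn⟩ := large r m hr
    refine measure_mono_null (ball_subset_ball hn) ?_
    have := key x r hr n
    simpa [h0] using this
  have hfin : ∀ (x : M) (r : ℝ), μ (ball x r) < ∞ := by
    intro x r
    obtain ⟨s, hs, hs'⟩ := (μ.finiteAt_nhds x).exists_mem_basis nhds_basis_ball
    obtain ⟨n, hn⟩ := large s r hs
    refine (measure_mono (ball_subset_ball hn)).trans_lt ((key x s hs n).trans_lt ?_)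
    exact ENNReal.mul_lt_top (by finiteness) hs'
  exact ⟨max K 1, le_max_right _ _, fun x r hr => (hK x r hr).trans
    (by gcongr; exact le_max_left _ _), hpos, hfin⟩

namespace DoublingWith

variable (h : DoublingWith μ K)
include h

lemma measure_ball_le {x y : M} {r s : ℝ} (hs : 0 < s) (n : ℕ) (hle : dist x y + r ≤ 2 ^ n * s) :
    μ (ball x r) ≤ (K : ℝ≥0∞) ^ n * μ (ball y s) := by
  refine le_trans (measure_mono ?_) (measure_ball_two_pow_mul_le h.doubling y hs n)
  exact ball_subset_ball' (by linarith)

lemma isLocallyFiniteMeasure : IsLocallyFiniteMeasure μ :=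
  ⟨fun x => ⟨ball x 1, ball_mem_nhds x one_pos, h.lt_top x 1⟩⟩

lemma isUnifLocDoublingMeasure : IsUnifLocDoublingMeasure μ := by
  refine ⟨K ^ 2, ?_⟩
  filter_upwards [self_mem_nhdsWithin] with r hr x
  have hr : 0 < r := hr
  calc μ (closedBall x (2 * r)) ≤ μ (ball x (2 ^ 2 * r)) :=
        measure_mono (closedBall_subset_ball (by linarith))
    _ ≤ (K : ℝ≥0∞) ^ 2 * μ (ball x r) := measure_ball_two_pow_mul_le h.doubling x hr 2
    _ ≤ _ := by
        push_cast
        gcongr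
        exact ball_subset_closedBall

end DoublingWith

omit [MeasurableSpace M] in
/-- A family of balls of bounded radii has a countable disjoint subfamily whose eightfold
enlargements cover the union. -/
lemma exists_countable_disjoint_balls [SecondCountableTopology M] {ι : Type*} (t : Set ι)
    (z : ι → M) (r : ι → ℝ) (R : ℝ) (hr : ∀ i ∈ t, 0 < r i) (hR : ∀ i ∈ t, r i ≤ R) :
    ∃ u ⊆ t, u.Countable ∧ u.PairwiseDisjoint (fun i => ball (z i) (r i)) ∧
      (⋃ i ∈ t, ball (z i) (r i)) ⊆ ⋃ i ∈ u, ball (z i) (8 * r i) := by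
  obtain ⟨u, hut, hdisj, hcov⟩ :=
    Vitali.exists_disjoint_subfamily_covering_enlargement_ball t z r R hR 8 (by norm_num)
  refine ⟨u, hut, ?_, hdisj, ?_⟩
  · exact hdisj.countable_of_isOpen (fun i _ => isOpen_ball)
      (fun i hi => nonempty_ball.2 (hr i (hut hi)))
  · refine iUnion₂_subset fun i hi => ?_
    obtain ⟨j, hj, hsub⟩ := hcov i hi
    exact hsub.trans (subset_biUnion_of_mem (u := fun j => ball (z j) (8 * r j)) hj)

/-- A comparison of two measures on single balls passes to unions of balls: the enlarged Vitali
balls cover, while the original ones are disjoint. The maximal inequality and the reverse Hölder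
inequality both rest on this, with different choices of `ν` and `κ`. -/
lemma measure_iUnion_ball_le [SecondCountableTopology M] [BorelSpace M] {ι : Type*} (t : Set ι)
    (z : ι → M) (r : ι → ℝ) (R : ℝ) (hr : ∀ i ∈ t, 0 < r i) (hR : ∀ i ∈ t, r i ≤ R)
    (ν κ : Measure M) (c : ℝ≥0∞)
    (hc : ∀ i ∈ t, ν (ball (z i) (8 * r i)) ≤ c * κ (ball (z i) (r i))) :
    ν (⋃ i ∈ t, ball (z i) (r i)) ≤ c * κ (⋃ i ∈ t, ball (z i) (r i)) := by
  obtain ⟨u, hut, hcount, hdisj, hcov⟩ := exists_countable_disjoint_balls t z r R hr hR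
  have := hcount.to_subtype
  calc ν (⋃ i ∈ t, ball (z i) (r i)) ≤ ν (⋃ i ∈ u, ball (z i) (8 * r i)) := measure_mono hcov
    _ ≤ ∑' i : u, ν (ball (z i) (8 * r i)) := measure_biUnion_le ν hcount _
    _ ≤ ∑' i : u, c * κ (ball (z i) (r i)) := by
        gcongr with i
        exact hc i (hut i.2)
    _ = c * ∑' i : u, κ (ball (z i) (r i)) := ENNReal.tsum_mul_left
    _ = c * κ (⋃ i ∈ u, ball (z i) (r i)) := by
        rw [measure_biUnion hcount hdisj (fun i _ => measurableSet_ball)]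
    _ ≤ _ := by
        gcongr
        exact iUnion_subset fun hi => subset_iUnion_of_subset (hut hi) subset_rfl

end Doubling

/-! ### Layer cake formula and the maximal operator. -/

/-- The layer cake formula for a function with values in `[0, ∞]`. -/
lemma lintegral_ennreal_rpow_eq {α : Type*} [MeasurableSpace α] (ν : Measure α) {f : α → ℝ≥0∞}
    (hf : AEMeasurable f ν) (hfin : ∀ᵐ x ∂ν, f x ≠ ∞) {p : ℝ} (hp : 0 < p) :
    ∫⁻ x, f x ^ p ∂ν = ENNReal.ofReal p *
      ∫⁻ t in Ioi (0 : ℝ), ν {x | ENNReal.ofReal t < f x} * ENNReal.ofReal (t ^ (p - 1)) := by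
  have := lintegral_rpow_eq_lintegral_meas_lt_mul ν (f := fun x => (f x).toReal)
    (Filter.Eventually.of_forall fun x => ENNReal.toReal_nonneg) hf.ennreal_toReal hp
  have e1 : ∫⁻ x, f x ^ p ∂ν = ∫⁻ x, ENNReal.ofReal ((f x).toReal ^ p) ∂ν := by
    refine lintegral_congr_ae ?_
    filter_upwards [hfin] with x hx
    rw [← ENNReal.ofReal_rpow_of_nonneg ENNReal.toReal_nonneg hp.le, ENNReal.ofReal_toReal hx]
  rw [e1, this]
  congr 1
  refine setLIntegral_congr_fun measurableSet_Ioi fun t ht => ?_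
  congr 1
  refine measure_congr ?_
  filter_upwards [hfin] with x hx
  refine propext ?_
  exact (ENNReal.ofReal_lt_iff_lt_toReal (le_of_lt ht) hx).symm

/-- The strong type estimate for the maximal operator of a finite family of balls, with the
sharp dependence on the exponent. -/
theorem lintegral_maximal_rpow_le {M : Type*} [MetricSpace M] [SecondCountableTopology M]
    [MeasurableSpace M] [BorelSpace M] {μ : Measure M} {K : ℝ≥0} (h : DoublingWith μ K)
    {ι : Type*} (T : Finset ι) (z : ι → M) (r : ι → ℝ) (hr : ∀ i ∈ T, 0 < r i)
    {f : M → ℝ≥0∞} (hf : AEMeasurable f μ) {q : ℝ} (hq : 1 < q) :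
    ∫⁻ x, (⨆ i ∈ T, (ball (z i) (r i)).indicator
        (fun _ => ⨍⁻ y in ball (z i) (r i), f y ∂μ) x) ^ q ∂μ ≤
      ENNReal.ofReal (2 ^ q * (q / (q - 1))) * (K : ℝ≥0∞) ^ 3 * ∫⁻ x, f x ^ q ∂μ := by
  have hq0 : 0 < q := by linarith
  have hq1 : 0 < q - 1 := by linarith
  by_cases hfin : ∫⁻ x, f x ^ q ∂μ = ∞
  · have hK : (K : ℝ≥0∞) ^ 3 ≠ 0 := by
      have := h.one_le
      have : (K : ℝ≥0∞) ≠ 0 := by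
        simpa using (lt_of_lt_of_le one_pos h.one_le).ne'
      positivity
    rw [hfin, ENNReal.mul_top]
    · exact le_top
    · refine mul_ne_zero ?_ hK
      simp only [ne_eq, ENNReal.ofReal_eq_zero, not_le]
      positivity
  have hf_top : ∀ᵐ x ∂μ, f x ≠ ∞ := by
    filter_upwards [ae_lt_top' (hf.pow_const q) hfin] with x hx
    intro h'
    simp [h', hq0] at hx
  have havg : ∀ i, ⨍⁻ y in ball (z i) (r i), f y ∂μ ≠ ∞ := by
    intro i
    refine (setLAverage_lt_top (ne_of_lt ?_)).ne
    calc ∫⁻ y in ball (z i) (r i), f y ∂μ ≤ ∫⁻ y in ball (z i) (r i), (1 + f y ^ q) ∂μ := by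
          gcongr with y
          rcases le_total (f y) 1 with h1 | h1
          · exact h1.trans le_self_add
          · exact (by simpa using ENNReal.rpow_le_rpow_of_exponent_le h1 hq.le :
              f y ≤ f y ^ q).trans le_add_self
      _ = μ (ball (z i) (r i)) + ∫⁻ y in ball (z i) (r i), f y ^ q ∂μ := by
          rw [lintegral_add_left measurable_const]; simp
      _ < ∞ := by
          refine ENNReal.add_lt_top.2 ⟨h.lt_top _ _, ?_⟩
          exact (setLIntegral_le_lintegral _ _).trans_lt (lt_top_iff_ne_top.2 hfin)
  set m : M → ℝ≥0∞ := fun x => ⨆ i ∈ T, (ball (z i) (r i)).indicator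
        (fun _ => ⨍⁻ y in ball (z i) (r i), f y ∂μ) x with hm
  have hm_meas : Measurable m := by
    refine Measurable.biSup _ T.countable_toSet fun i _ => ?_
    exact measurable_const.indicator measurableSet_ball
  have hm_top : ∀ x, m x ≠ ∞ := by
    intro x
    refine ne_of_lt ?_
    simp only [hm]
    rw [← Finset.sup_eq_iSup, Finset.sup_lt_iff ENNReal.coe_lt_top]
    intro i _
    refine lt_of_le_of_lt (indicator_le_self _ _ x) (lt_top_iff_ne_top.2 (havg i))
  obtain ⟨R, hR⟩ : ∃ R, ∀ i ∈ T, r i ≤ R := by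
    obtain ⟨R, hR⟩ := (T.finite_toSet.image r).bddAbove
    exact ⟨R, fun i hi => hR ⟨i, hi, rfl⟩⟩
  -- The weak type estimate in its localised form: on a ball where the average of `f` exceeds `t`,
  -- the part of `f` below `t / 2` accounts for at most half of `t`, so only the mass of `f` on `{2
  -- f > t}` is needed.
  have weak : ∀ t : ℝ, 0 < t → ENNReal.ofReal (t / 2) * μ {x | ENNReal.ofReal t < m x} ≤
      (K : ℝ≥0∞) ^ 3 * (μ.withDensity f) {x | ENNReal.ofReal t < 2 * f x} := by
    intro t ht
    set s : Set ι := {i | i ∈ T ∧ ENNReal.ofReal t < ⨍⁻ y in ball (z i) (r i), f y ∂μ}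
    set A : Set M := {x | ENNReal.ofReal t < 2 * f x}
    have hA : NullMeasurableSet A (μ.withDensity f) := by
      have : AEMeasurable (fun x => 2 * f x) (μ.withDensity f) :=
        (hf.const_mul 2).mono_ac (withDensity_absolutelyContinuous _ _)
      exact nullMeasurableSet_lt aemeasurable_const this
    have hA' : NullMeasurableSet A μ := nullMeasurableSet_lt aemeasurable_const (hf.const_mul 2)
    have hsub : {x | ENNReal.ofReal t < m x} ⊆ ⋃ i ∈ s, ball (z i) (r i) := by
      intro x hx
      simp only [hm, mem_ofPred_eq, lt_iSup_iff] at hx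
      obtain ⟨i, hi, hx⟩ := hx
      by_cases hxi : x ∈ ball (z i) (r i)
      · rw [indicator_of_mem hxi] at hx
        exact mem_biUnion (show i ∈ s from ⟨hi, hx⟩) hxi
      · simp [indicator_of_notMem hxi] at hx
    have main := measure_iUnion_ball_le s z r R (fun i hi => hr i hi.1) (fun i hi => hR i hi.1)
      (ENNReal.ofReal (t / 2) • μ) ((μ.withDensity f).restrict A) ((K : ℝ≥0∞) ^ 3) (by
        intro i hi
        have hri := hr i hi.1
        have h1 : μ (ball (z i) (8 * r i)) ≤ (K : ℝ≥0∞) ^ 3 * μ (ball (z i) (r i)) :=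
          h.measure_ball_le hri 3 (by simp; linarith)
        have hBpos := (h.pos (z i) (r i) hri).ne'
        have hBfin := (h.lt_top (z i) (r i)).ne
        have h2 : ENNReal.ofReal (t / 2) * μ (ball (z i) (r i)) ≤
            (μ.withDensity f).restrict A (ball (z i) (r i)) := by
          have h3 : ENNReal.ofReal t * μ (ball (z i) (r i)) ≤
              ∫⁻ y in ball (z i) (r i), f y ∂μ := by
            have := hi.2.le
            rw [setLAverage_eq, ENNReal.le_div_iff_mul_le (Or.inl hBpos) (Or.inl hBfin)] at this
            exact this
          have h4 : ∫⁻ y in ball (z i) (r i), f y ∂μ ≤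
              ENNReal.ofReal (t / 2) * μ (ball (z i) (r i)) +
                (μ.withDensity f).restrict A (ball (z i) (r i)) := by
            rw [Measure.restrict_apply measurableSet_ball]
            calc ∫⁻ y in ball (z i) (r i), f y ∂μ
                ≤ ∫⁻ y in ball (z i) (r i), (ENNReal.ofReal (t / 2) + A.indicator f y) ∂μ := by
                  gcongr with y
                  by_cases hy : y ∈ A
                  · simp [indicator_of_mem hy]
                  · rw [indicator_of_notMem hy, add_zero]
                    have : 2 * f y ≤ ENNReal.ofReal t := not_lt.1 hy
                    rw [ENNReal.ofReal_div_of_pos two_pos,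
                      ENNReal.le_div_iff_mul_le (by simp) (by simp), mul_comm]
                    simpa using this
              _ = ENNReal.ofReal (t / 2) * μ (ball (z i) (r i)) +
                  ∫⁻ y in ball (z i) (r i), A.indicator f y ∂μ := by
                  rw [lintegral_add_left measurable_const]; simp
              _ = _ := by
                  congr 1
                  rw [lintegral_indicator₀ (hA'.mono_ac Measure.absolutelyContinuous_restrict), Measure.restrict_restrict₀
                    (hA'.mono_ac Measure.absolutelyContinuous_restrict), inter_comm A]
                  exact (withDensity_apply₀ _ (measurableSet_ball.nullMeasurableSet.inter hA')).symm
          have h5 : ENNReal.ofReal t = ENNReal.ofReal (t / 2) + ENNReal.ofReal (t / 2) := by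
            rw [← ENNReal.ofReal_add (by positivity) (by positivity)]; simp
          rw [h5, add_mul] at h3
          refine (ENNReal.add_le_add_iff_left (a := ENNReal.ofReal (t / 2) *
            μ (ball (z i) (r i))) (by finiteness)).1 (h3.trans h4)
        calc (ENNReal.ofReal (t / 2) • μ) (ball (z i) (8 * r i))
            = ENNReal.ofReal (t / 2) * μ (ball (z i) (8 * r i)) := by simp
          _ ≤ ENNReal.ofReal (t / 2) * ((K : ℝ≥0∞) ^ 3 * μ (ball (z i) (r i))) := by gcongr
          _ = (K : ℝ≥0∞) ^ 3 * (ENNReal.ofReal (t / 2) * μ (ball (z i) (r i))) := by ring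
          _ ≤ _ := by gcongr)
    calc ENNReal.ofReal (t / 2) * μ {x | ENNReal.ofReal t < m x}
        ≤ ENNReal.ofReal (t / 2) * μ (⋃ i ∈ s, ball (z i) (r i)) := by gcongr
      _ = (ENNReal.ofReal (t / 2) • μ) (⋃ i ∈ s, ball (z i) (r i)) := by simp
      _ ≤ _ := main
      _ ≤ _ := by
        gcongr (K : ℝ≥0∞) ^ 3 * ?_
        exact (measure_mono (subset_univ _)).trans_eq (Measure.restrict_apply_univ A)
  have hf2 : AEMeasurable (fun x => 2 * f x) (μ.withDensity f) :=
    (hf.const_mul 2).mono_ac (withDensity_absolutelyContinuous _ _)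
  have hf2_top : ∀ᵐ x ∂(μ.withDensity f), 2 * f x ≠ ∞ := by
    refine (withDensity_absolutelyContinuous μ f).ae_le ?_
    filter_upwards [hf_top] with x hx using by finiteness
  calc ∫⁻ x, m x ^ q ∂μ
      = ENNReal.ofReal q * ∫⁻ t in Ioi (0 : ℝ), μ {x | ENNReal.ofReal t < m x} *
          ENNReal.ofReal (t ^ (q - 1)) :=
        lintegral_ennreal_rpow_eq μ hm_meas.aemeasurable (Filter.Eventually.of_forall hm_top) hq0
    _ ≤ ENNReal.ofReal q * ∫⁻ t in Ioi (0 : ℝ), (2 * (K : ℝ≥0∞) ^ 3) *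
          ((μ.withDensity f) {x | ENNReal.ofReal t < 2 * f x} *
            ENNReal.ofReal (t ^ (q - 1 - 1))) := by
        gcongr ENNReal.ofReal q * ?_
        refine setLIntegral_mono' measurableSet_Ioi fun t ht => ?_
        have ht : 0 < t := ht
        -- One power of `t` is spent on the weak estimate. What remains is the layer cake integral
        -- of `(2 f) ^ (q - 1)` against `f dμ`; its missing normalisation `q - 1` produces the
        -- factor `q / (q - 1)`.
        have e : ENNReal.ofReal (t ^ (q - 1)) =
            2 * ENNReal.ofReal (t / 2) * ENNReal.ofReal (t ^ (q - 1 - 1)) := by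
          rw [show (2 : ℝ≥0∞) = ENNReal.ofReal 2 by simp, ← ENNReal.ofReal_mul (by simp),
            ← ENNReal.ofReal_mul (by positivity)]
          congr 1
          rw [Real.rpow_sub_one ht.ne' (q - 1)]
          field_simp
        calc μ {x | ENNReal.ofReal t < m x} * ENNReal.ofReal (t ^ (q - 1))
            = 2 * (ENNReal.ofReal (t / 2) * μ {x | ENNReal.ofReal t < m x}) *
              ENNReal.ofReal (t ^ (q - 1 - 1)) := by rw [e]; ring
          _ ≤ 2 * ((K : ℝ≥0∞) ^ 3 * (μ.withDensity f) {x | ENNReal.ofReal t < 2 * f x}) *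
              ENNReal.ofReal (t ^ (q - 1 - 1)) := by
              gcongr 2 * ?_ * _
              exact weak t ht
          _ = _ := by ring
    _ = (ENNReal.ofReal q * (2 * (K : ℝ≥0∞) ^ 3)) * ∫⁻ t in Ioi (0 : ℝ),
          ((μ.withDensity f) {x | ENNReal.ofReal t < 2 * f x} *
            ENNReal.ofReal (t ^ (q - 1 - 1))) := by
        rw [lintegral_const_mul' _ _ (by finiteness)]
        ring
    _ = (ENNReal.ofReal (q / (q - 1)) * (2 * (K : ℝ≥0∞) ^ 3)) *
          ∫⁻ x, (2 * f x) ^ (q - 1) ∂(μ.withDensity f) := by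
        have : ENNReal.ofReal q = ENNReal.ofReal (q / (q - 1)) * ENNReal.ofReal (q - 1) := by
          rw [← ENNReal.ofReal_mul (by positivity)]
          congr 1
          field_simp
        rw [lintegral_ennreal_rpow_eq (μ.withDensity f) hf2 hf2_top hq1, this]
        ring
    _ = (ENNReal.ofReal (q / (q - 1)) * (2 * (K : ℝ≥0∞) ^ 3)) *
          ∫⁻ x, ENNReal.ofReal (2 ^ (q - 1)) * f x ^ q ∂μ := by
        rw [lintegral_withDensity_eq_lintegral_mul₀ hf ((hf.const_mul 2).pow_const _)]
        congr 1
        refine lintegral_congr_ae ?_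
        filter_upwards [hf_top] with x hx
        simp only [Pi.mul_apply]
        rw [ENNReal.mul_rpow_of_nonneg _ _ hq1.le, ← ENNReal.ofReal_rpow_of_pos two_pos]
        have : f x ^ q = f x * f x ^ (q - 1) := by
          nth_rw 2 [← ENNReal.rpow_one (f x)]
          rw [← ENNReal.rpow_add_of_nonneg _ _ zero_le_one hq1.le]
          simp
        rw [this]
        simp only [ENNReal.ofReal_ofNat]
        ring
    _ = _ := by
        rw [lintegral_const_mul' _ _ (by finiteness), ← mul_assoc]
        congr 1
        have : (2 : ℝ) ^ q = 2 ^ (q - 1) * 2 := by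
          rw [Real.rpow_sub_one two_ne_zero]; field_simp
        rw [this, ENNReal.ofReal_mul (by positivity), ENNReal.ofReal_mul (by positivity)]
        simp only [ENNReal.ofReal_ofNat]
        ring

/-! ### Scalar Muckenhoupt weights and their level sets. -/

section ReverseHolder

variable {M : Type*} [MetricSpace M] [MeasurableSpace M] {μ : Measure M} {K : ℝ≥0}

/-- A scalar weight satisfying the Muckenhoupt condition
`(⨍ w) (⨍ w ^ (-κ)) ^ (1 / κ) ≤ N` on all balls. -/
structure IsScalarWeight (μ : Measure M) (κ N : ℝ) (w : M → ℝ≥0∞) : Prop where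
  aemeasurable : AEMeasurable w μ
  ne_zero : ∀ᵐ x ∂μ, w x ≠ 0
  ne_top : ∀ᵐ x ∂μ, w x ≠ ∞
  le : ∀ z r, 0 < r → (⨍⁻ x in ball z r, w x ∂μ) *
    (⨍⁻ x in ball z r, w x ^ (-κ) ∂μ) ^ (1 / κ) ≤ ENNReal.ofReal N

namespace IsScalarWeight

variable {κ N : ℝ} {w : M → ℝ≥0∞}

/-- Local integrability is not assumed: since `w` is finite almost everywhere, the average of `w ^
(-κ)` is nonzero, so an infinite average of `w` would make the bounded product infinite. -/
lemma setLAverage_lt_top (hw : IsScalarWeight μ κ N w) (h : DoublingWith μ K) (hκ : 0 < κ)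
    (z : M) {r : ℝ} (hr : 0 < r) : ⨍⁻ x in ball z r, w x ∂μ < ∞ := by
  rw [lt_top_iff_ne_top]
  intro htop
  have hle := hw.le z r hr
  have hpos : ⨍⁻ x in ball z r, w x ^ (-κ) ∂μ ≠ 0 := by
    rw [setLAverage_eq, ne_eq, ENNReal.div_eq_zero_iff, not_or]
    refine ⟨?_, (h.lt_top z r).ne⟩
    rw [lintegral_eq_zero_iff' (hw.aemeasurable.pow_const _).restrict]
    intro h0
    have h1 : ∀ᵐ x ∂(μ.restrict (ball z r)), False := by
      filter_upwards [h0, ae_restrict_of_ae hw.ne_top] with x hx hx'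
      simp only [Pi.zero_apply, ENNReal.rpow_eq_zero_iff] at hx
      rcases hx with hx | hx
      · linarith [hx.2]
      · exact hx' hx.1
    have h2 : μ.restrict (ball z r) = 0 := by
      rw [← ae_eq_bot]; exact Filter.eventually_false_iff_eq_bot.1 h1
    rw [Measure.restrict_eq_zero] at h2
    exact (h.pos z r hr).ne' h2
  rw [htop, ENNReal.top_mul] at hle
  · simp at hle
  · simp only [one_div, ne_eq, ENNReal.rpow_eq_zero_iff, inv_pos, inv_neg'', not_or, not_and]
    exact ⟨fun h0 => absurd h0 hpos, fun _ => by linarith⟩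

lemma setLIntegral_lt_top (hw : IsScalarWeight μ κ N w) (h : DoublingWith μ K) (hκ : 0 < κ)
    (z : M) {r : ℝ} (hr : 0 < r) : ∫⁻ x in ball z r, w x ∂μ < ∞ := by
  have := hw.setLAverage_lt_top h hκ z hr
  rw [setLAverage_eq] at this
  by_contra htop
  rw [not_lt_top_iff.1 htop, ENNReal.top_div_of_ne_top (h.lt_top z r).ne] at this
  exact lt_irrefl _ this

variable [BorelSpace M]

/-- A scalar weight is at least a multiple of its average on half of each ball. -/
lemma measure_ball_le_two_mul (hw : IsScalarWeight μ κ N w) (h : DoublingWith μ K) (hκ : 0 < κ)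
    (hN : 0 < N) (z : M) {r : ℝ} (hr : 0 < r) {s : ℝ} (hs : 0 < s)
    (hsw : ENNReal.ofReal s ≤ ⨍⁻ x in ball z r, w x ∂μ) :
    μ (ball z r) ≤ 2 * μ.restrict {x | ENNReal.ofReal (2⁻¹ ^ (1 / κ) / N * s) ≤ w x}
      (ball z r) := by
  -- Chosen so that `(θ s) ^ (-κ) = 2 (N / s) ^ κ`. Chebyshev's inequality for `w ^ (-κ)` then
  -- leaves at most half of the ball below `θ s`.
  set θ : ℝ := 2⁻¹ ^ (1 / κ) / N with hθ
  have hθpos : 0 < θ := by positivity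
  have hBpos := (h.pos z r hr).ne'
  have hBfin := (h.lt_top z r).ne
  set A := ⨍⁻ x in ball z r, w x ^ (-κ) ∂μ with hA
  have hA_le : A ≤ ENNReal.ofReal ((N / s) ^ κ) := by
    have h1 : ENNReal.ofReal s * A ^ (1 / κ) ≤ ENNReal.ofReal N :=
      (mul_le_mul_left hsw _).trans (hw.le z r hr)
    have h2 : A ^ (1 / κ) ≤ ENNReal.ofReal (N / s) := by
      rw [ENNReal.ofReal_div_of_pos hs, ENNReal.le_div_iff_mul_le (by simp [hs]) (by simp), mul_comm]
      exact h1
    have h3 := ENNReal.rpow_le_rpow h2 hκ.le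
    rwa [← ENNReal.rpow_mul, one_div, inv_mul_cancel₀ hκ.ne', ENNReal.rpow_one,
      ENNReal.ofReal_rpow_of_nonneg (by positivity) hκ.le] at h3
  have hcheb : ENNReal.ofReal ((θ * s) ^ (-κ)) *
      μ.restrict (ball z r) {x | w x < ENNReal.ofReal (θ * s)} ≤
      ENNReal.ofReal ((N / s) ^ κ) * μ (ball z r) := by
    calc _ ≤ ENNReal.ofReal ((θ * s) ^ (-κ)) *
          μ.restrict (ball z r) {x | ENNReal.ofReal ((θ * s) ^ (-κ)) ≤ w x ^ (-κ)} := by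
          gcongr with x
          intro hx
          rw [← ENNReal.ofReal_rpow_of_pos (by positivity)]
          rw [ENNReal.rpow_neg, ENNReal.rpow_neg, ENNReal.inv_le_inv]
          exact ENNReal.rpow_le_rpow (le_of_lt hx) hκ.le
      _ ≤ ∫⁻ x in ball z r, w x ^ (-κ) ∂μ :=
          mul_meas_ge_le_lintegral₀ (hw.aemeasurable.pow_const _).restrict _
      _ = A * μ (ball z r) := by
          rw [hA, setLAverage_eq, ENNReal.div_mul_cancel hBpos hBfin]
      _ ≤ _ := by gcongr
  have hθs : (θ * s) ^ (-κ) = (N / s) ^ κ * 2 := by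
    rw [Real.rpow_neg (by positivity), ← Real.inv_rpow (by positivity), hθ]
    have : (2⁻¹ ^ (1 / κ) / N * s : ℝ)⁻¹ = N / s * 2 ^ (1 / κ) := by
      rw [Real.inv_rpow (by norm_num)]
      field_simp
    rw [this, Real.mul_rpow (by positivity) (by positivity), ← Real.rpow_mul (by norm_num),
      one_div, inv_mul_cancel₀ hκ.ne', Real.rpow_one]
  have hbad : 2 * μ.restrict (ball z r) {x | w x < ENNReal.ofReal (θ * s)} ≤ μ (ball z r) := by
    rw [hθs, ENNReal.ofReal_mul (by positivity), mul_assoc] at hcheb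
    have hne : ENNReal.ofReal ((N / s) ^ κ) ≠ 0 := by
      simp only [ne_eq, ENNReal.ofReal_eq_zero, not_le]; positivity
    have := (ENNReal.mul_le_mul_iff_right hne (by simp)).1 hcheb
    simpa using this
  have hsplit : μ (ball z r) ≤ μ.restrict (ball z r) {x | w x < ENNReal.ofReal (θ * s)} +
      μ.restrict {x | ENNReal.ofReal (θ * s) ≤ w x} (ball z r) := by
    rw [Measure.restrict_apply measurableSet_ball,
      Measure.restrict_apply₀ (nullMeasurableSet_lt hw.aemeasurable.restrict aemeasurable_const)]
    refine le_trans (measure_mono ?_) (measure_union_le _ _)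
    intro x hx
    rcases lt_or_ge (w x) (ENNReal.ofReal (θ * s)) with h1 | h1
    · exact Or.inl ⟨h1, hx⟩
    · exact Or.inr ⟨hx, h1⟩
  set X := μ.restrict (ball z r) {x | w x < ENNReal.ofReal (θ * s)}
  set Y := μ.restrict {x | ENNReal.ofReal (θ * s) ≤ w x} (ball z r)
  have hYX : 2 * μ (ball z r) ≤ μ (ball z r) + 2 * Y := by
    calc 2 * μ (ball z r) ≤ 2 * (X + Y) := by gcongr
      _ = 2 * X + 2 * Y := by ring
      _ ≤ _ := by gcongr
  rw [two_mul] at hYX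
  exact (ENNReal.add_le_add_iff_left hBfin).1 hYX

variable [SecondCountableTopology M]

/-- The estimate of the mass of a level set of a weight by the measure of a lower level set. -/
lemma withDensity_levelSet_le (hw : IsScalarWeight μ κ N w) (h : DoublingWith μ K) (hκ : 0 < κ)
    (hN : 0 < N) (z : M) {R ρ : ℝ} (hR : 0 < R) (hρ : 0 < ρ) {s : ℝ} (hs : 0 < s)
    (hsw : ∀ x ∈ ball z R, ∀ k ≤ 3, ⨍⁻ y in ball x (ρ / 2 ^ k), w y ∂μ ≤ ENNReal.ofReal s) :
    (μ.withDensity w).restrict (ball z R) {x | K * ENNReal.ofReal s < w x} ≤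
      2 * (K : ℝ≥0∞) ^ 3 * ENNReal.ofReal s *
        μ.restrict (ball z (R + ρ)) {x | ENNReal.ofReal (2⁻¹ ^ (1 / κ) / N * s) ≤ w x} := by
  classical
  have := h.isUnifLocDoublingMeasure
  have := h.isLocallyFiniteMeasure
  set θ : ℝ := 2⁻¹ ^ (1 / κ) / N with hθ
  set t : Set M := {x | x ∈ ball z R ∧
    ∃ k : ℕ, ENNReal.ofReal s < ⨍⁻ y in ball x (ρ / 2 ^ k), w y ∂μ} with ht
  -- A stopping time: the first dyadic radius at which the average exceeds `s`. By hypothesis this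
  -- does not happen for `k ≤ 3`, so the radius three generations back, which is eight times as
  -- large, is available and has average at most `s`.
  have hkex : ∀ x : M, ∃ k : ℕ, x ∈ t →
      3 < k ∧ ENNReal.ofReal s < ⨍⁻ y in ball x (ρ / 2 ^ k), w y ∂μ ∧
      ⨍⁻ y in ball x (8 * (ρ / 2 ^ k)), w y ∂μ ≤ ENNReal.ofReal s := by
    intro x
    by_cases hx : x ∈ t
    swap
    · exact ⟨0, fun hx' => absurd hx' hx⟩
    refine ⟨Nat.find hx.2, fun _ => ?_⟩
    have h1 := Nat.find_spec hx.2
    have h3 : 3 < Nat.find hx.2 := by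
      by_contra hle
      exact absurd (hsw x hx.1 _ (not_lt.1 hle)) (not_le.2 h1)
    refine ⟨h3, h1, ?_⟩
    have h4 := Nat.find_min hx.2 (m := Nat.find hx.2 - 3) (by omega)
    rw [not_lt] at h4
    have h5 : ∀ m : ℕ, 3 < m → 8 * (ρ / 2 ^ m) = ρ / 2 ^ (m - 3) := by
      intro m hm
      obtain ⟨n, rfl⟩ := Nat.exists_eq_add_of_lt hm
      rw [show 3 + n + 1 - 3 = n + 1 by omega, show 3 + n + 1 = (n + 1) + 3 by ring, pow_add]
      field_simp
      norm_num
    rwa [h5 _ h3]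
  choose k hk using hkex
  have hr : ∀ x ∈ t, 0 < ρ / 2 ^ k x := fun x _ => by positivity
  have hr_le : ∀ x ∈ t, ρ / 2 ^ k x ≤ ρ := fun x _ =>
    div_le_self hρ.le (one_le_pow₀ one_le_two)
  have hmeas : NullMeasurableSet {x | ENNReal.ofReal (θ * s) ≤ w x} μ :=
    nullMeasurableSet_le aemeasurable_const hw.aemeasurable
  have hcover : (μ.withDensity w).restrict (ball z R) {x | K * ENNReal.ofReal s < w x} ≤
      (μ.withDensity w) (⋃ x ∈ t, ball x (ρ / 2 ^ k x)) := by
    -- The weight is cut off to a ball, because it is only locally integrable; the averages near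
    -- points of `ball z R` are unaffected in the limit.
    have hleb := VitaliFamily.ae_tendsto_lintegral_div
      (IsUnifLocDoublingMeasure.vitaliFamily μ (1 : ℝ))
      (f := (ball z (R + ρ)).indicator w) (hw.aemeasurable.indicator measurableSet_ball) (by
        rw [lintegral_indicator measurableSet_ball]
        exact (hw.setLIntegral_lt_top h hκ z (by positivity)).ne)
    rw [Measure.restrict_apply₀]
    swap
    · exact (nullMeasurableSet_lt aemeasurable_const hw.aemeasurable).mono_ac
        (Measure.absolutelyContinuous_restrict.trans (withDensity_absolutelyContinuous _ _))
    refine measure_mono_ae ?_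
    refine (withDensity_absolutelyContinuous μ w).ae_le ?_
    filter_upwards [hleb] with x hx
    rintro ⟨hxw, hxR⟩
    have hxw : K * ENNReal.ofReal s < w x := hxw
    have hxR2 : x ∈ ball z (R + ρ) := ball_subset_ball (by linarith) hxR
    have hlim : Filter.Tendsto (fun n : ℕ => closedBall x (ρ / 2 ^ (n + 1))) Filter.atTop
        ((IsUnifLocDoublingMeasure.vitaliFamily μ (1 : ℝ)).filterAt x) := by
      refine IsUnifLocDoublingMeasure.tendsto_closedBall_filterAt μ (K := 1) _ _ ?_ ?_
      · rw [tendsto_nhdsWithin_iff]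
        refine ⟨?_, Filter.Eventually.of_forall fun n => by
          simp only [mem_Ioi]; positivity⟩
        have := ((tendsto_pow_atTop_nhds_zero_of_lt_one (r := (2 : ℝ)⁻¹) (by norm_num)
          (by norm_num)).comp (Filter.tendsto_add_atTop_nat 1)).const_mul ρ
        simpa [div_eq_mul_inv, Function.comp_def] using this
      · exact Filter.Eventually.of_forall fun n => mem_closedBall_self (by positivity)
    have hx2 := hx.comp hlim
    rw [indicator_of_mem hxR2] at hx2
    obtain ⟨n, hn⟩ := (hx2.eventually (lt_mem_nhds hxw)).exists
    -- Differentiation uses closed balls and the stopping time uses open ones of twice the radius.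
    -- The factor `K` in the level `K s` pays for this passage.
    have hxt : x ∈ t := by
      refine ⟨hxR, n, ?_⟩
      have hb : 0 < ρ / 2 ^ n := by positivity
      have hb' : 0 < ρ / 2 ^ (n + 1) := by positivity
      have e2 : 2 * (ρ / 2 ^ (n + 1)) = ρ / 2 ^ n := by rw [pow_succ]; field_simp
      rw [setLAverage_eq, ENNReal.lt_div_iff_mul_lt (Or.inl (h.pos _ _ hb).ne')
        (Or.inl (h.lt_top _ _).ne)]
      have hcb0 : μ (closedBall x (ρ / 2 ^ (n + 1))) ≠ 0 :=
        ((h.pos _ _ hb').trans_le (measure_mono ball_subset_closedBall)).ne'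
      have hcbsub : closedBall x (ρ / 2 ^ (n + 1)) ⊆ ball x (ρ / 2 ^ n) :=
        closedBall_subset_ball (by rw [← e2]; linarith)
      have hcbt : μ (closedBall x (ρ / 2 ^ (n + 1))) ≠ ∞ :=
        ((measure_mono hcbsub).trans_lt (h.lt_top _ _)).ne
      simp only [Function.comp] at hn
      rw [ENNReal.lt_div_iff_mul_lt (Or.inl hcb0) (Or.inl hcbt)] at hn
      calc ENNReal.ofReal s * μ (ball x (ρ / 2 ^ n))
          ≤ ENNReal.ofReal s * (K * μ (ball x (ρ / 2 ^ (n + 1)))) := by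
            gcongr
            rw [← e2]
            exact h.doubling x _ hb'
        _ ≤ ENNReal.ofReal s * (K * μ (closedBall x (ρ / 2 ^ (n + 1)))) := by
            gcongr; exact ball_subset_closedBall
        _ = K * ENNReal.ofReal s * μ (closedBall x (ρ / 2 ^ (n + 1))) := by ring
        _ < _ := hn
        _ ≤ ∫⁻ y in closedBall x (ρ / 2 ^ (n + 1)), w y ∂μ :=
            lintegral_mono fun y => indicator_le_self _ _ y
        _ ≤ _ := lintegral_mono_set hcbsub
    exact mem_biUnion hxt (mem_ball_self (hr x hxt))
  -- On the eightfold ball the mass of `w` is at most `s` times its measure. Doubling returns to the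
  -- stopping ball, half of which lies in `{w ≥ θ s}` because its average exceeds `s`.
  have main := measure_iUnion_ball_le t id (fun x => ρ / 2 ^ k x) ρ hr hr_le
    (μ.withDensity w) (μ.restrict {x | ENNReal.ofReal (θ * s) ≤ w x})
    (2 * (K : ℝ≥0∞) ^ 3 * ENNReal.ofReal s) (by
      intro x hx
      have hrx := hr x hx
      obtain ⟨-, h1, h2⟩ := hk x hx
      simp only [id]
      rw [withDensity_apply _ measurableSet_ball]
      rw [setLAverage_eq, ENNReal.div_le_iff_le_mul (Or.inl (h.pos _ _ (by positivity)).ne')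
        (Or.inl (h.lt_top _ _).ne)] at h2
      refine h2.trans ?_
      have h3 := hw.measure_ball_le_two_mul h hκ hN x hrx hs h1.le
      have h4 : μ (ball x (8 * (ρ / 2 ^ k x))) ≤ (K : ℝ≥0∞) ^ 3 * μ (ball x (ρ / 2 ^ k x)) :=
        h.measure_ball_le hrx 3 (by simp; linarith)
      calc ENNReal.ofReal s * μ (ball x (8 * (ρ / 2 ^ k x)))
          ≤ ENNReal.ofReal s * ((K : ℝ≥0∞) ^ 3 * (2 *
            μ.restrict {x | ENNReal.ofReal (θ * s) ≤ w x} (ball x (ρ / 2 ^ k x)))) := by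
            gcongr
            refine h4.trans ?_
            gcongr
        _ = _ := by ring)
  refine hcover.trans (main.trans ?_)
  gcongr 2 * (K : ℝ≥0∞) ^ 3 * ENNReal.ofReal s * ?_
  have hsub : (⋃ x ∈ t, ball (id x) (ρ / 2 ^ k x)) ⊆ ball z (R + ρ) := by
    refine iUnion₂_subset fun x hx => ball_subset_ball' ?_
    have := hr_le x hx
    have := mem_ball.1 hx.1
    simp only [id]
    linarith
  refine (measure_mono hsub).trans ?_
  rw [Measure.restrict_apply measurableSet_ball,
    Measure.restrict_apply₀ (hmeas.mono_ac Measure.absolutelyContinuous_restrict), inter_comm]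

end IsScalarWeight

end ReverseHolder

/-! ### Truncation, absorption and the sharp reverse Hölder inequality. -/

/-- A truncated layer cake estimate from a comparison of level sets of two measures. -/
lemma lintegral_min_rpow_le {α : Type*} [MeasurableSpace α] {ν μ : Measure α} {w : α → ℝ≥0∞}
    (hν : AEMeasurable w ν) (hμ : AEMeasurable w μ) {C : ℝ≥0} {θ η t₀ : ℝ} (hθ : 0 < θ)
    (hθ1 : θ ≤ 1) (hη : 0 < η) (ht₀ : 0 ≤ t₀)
    (hle : ∀ t : ℝ, 0 < t → t₀ ≤ t → ν {x | ENNReal.ofReal t < w x} ≤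
      C * ENNReal.ofReal t * μ {x | ENNReal.ofReal (θ * t) < w x}) (n : ℝ≥0) :
    ∫⁻ x, (min (w x) n) ^ η ∂ν ≤ ENNReal.ofReal (t₀ ^ η) * ν univ +
      C * ENNReal.ofReal (η * θ⁻¹ ^ (1 + η)) * ∫⁻ x, w x * (min (w x) n) ^ η ∂μ := by
  have hη1 : 0 < 1 + η := by linarith
  -- Rescaled so that, for `t` below the truncation height `n`, the set `{w > θ t}` is exactly `{v >
  -- t}`.
  set v : α → ℝ≥0∞ := fun x => min (ENNReal.ofReal θ⁻¹ * w x) n with hv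
  have hv_meas : AEMeasurable v μ := (hμ.const_mul _).min aemeasurable_const
  have hv_top : ∀ x, v x ≠ ∞ := fun x => ((min_le_right _ _).trans_lt ENNReal.coe_lt_top).ne
  -- Levels below `t₀` are bounded trivially, and are recorded as the level sets of the constant
  -- function `t₀` so that the layer cake formula sums them.
  have hpt : ∀ t : ℝ, 0 < t → ν {x | ENNReal.ofReal t < min (w x) n} ≤
      ν {_x | ENNReal.ofReal t < ENNReal.ofReal t₀} +
        C * ENNReal.ofReal t * μ {x | ENNReal.ofReal t < v x} := by
    intro t ht
    rcases lt_or_ge t t₀ with h1 | h1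
    · refine le_trans (measure_mono fun x _ => ?_) le_self_add
      exact (ENNReal.ofReal_lt_ofReal_iff (by linarith)).2 h1
    · refine le_trans ?_ le_add_self
      rcases lt_or_ge (ENNReal.ofReal t) n with h2 | h2
      · refine (measure_mono fun x hx => ?_).trans ((hle t ht h1).trans ?_)
        · exact lt_of_lt_of_le (show ENNReal.ofReal t < min (w x) n from hx) (min_le_left _ _)
        · gcongr _ * ?_
          refine measure_mono fun x hx => ?_
          refine lt_min ?_ h2
          rw [ENNReal.ofReal_inv_of_pos hθ, mul_comm, ← div_eq_mul_inv,
            ENNReal.lt_div_iff_mul_lt (by simp [hθ]) (by simp), ← ENNReal.ofReal_mul ht.le, mul_comm]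
          exact hx
      · have : {x | ENNReal.ofReal t < min (w x) n} = ∅ := by
          refine eq_empty_of_forall_notMem fun x hx => ?_
          exact absurd (lt_of_lt_of_le (show ENNReal.ofReal t < min (w x) n from hx)
            (min_le_right _ _)) (not_lt.2 h2)
        rw [this]; simp
  have hconst : ENNReal.ofReal (t₀ ^ η) * ν univ = ENNReal.ofReal η *
      ∫⁻ t in Ioi (0 : ℝ), ν {_x | ENNReal.ofReal t < ENNReal.ofReal t₀} *
        ENNReal.ofReal (t ^ (η - 1)) := by
    rw [← lintegral_ennreal_rpow_eq ν (f := fun _ => ENNReal.ofReal t₀) aemeasurable_const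
      (Filter.Eventually.of_forall fun _ => by simp) hη, lintegral_const,
      ENNReal.ofReal_rpow_of_nonneg ht₀ hη.le]
  have hvint : ∫⁻ x, v x ^ (1 + η) ∂μ = ENNReal.ofReal (1 + η) *
      ∫⁻ t in Ioi (0 : ℝ), μ {x | ENNReal.ofReal t < v x} * ENNReal.ofReal (t ^ (1 + η - 1)) :=
    lintegral_ennreal_rpow_eq μ hv_meas (Filter.Eventually.of_forall hv_top) hη1
  have hvle : ∫⁻ x, v x ^ (1 + η) ∂μ ≤ ENNReal.ofReal (θ⁻¹ ^ (1 + η)) *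
      ∫⁻ x, w x * (min (w x) n) ^ η ∂μ := by
    rw [← lintegral_const_mul' _ _ (by finiteness)]
    refine lintegral_mono fun x => ?_
    have h1 : v x ≤ ENNReal.ofReal θ⁻¹ * min (w x) n := by
      rw [mul_min]
      refine min_le_min le_rfl ?_
      have : (1 : ℝ≥0∞) ≤ ENNReal.ofReal θ⁻¹ := by
        rw [ENNReal.one_le_ofReal]; exact (one_le_inv₀ hθ).2 hθ1
      calc (n : ℝ≥0∞) = 1 * n := (one_mul _).symm
        _ ≤ _ := by gcongr
    have h2 : v x ≤ ENNReal.ofReal θ⁻¹ * w x := min_le_left _ _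
    calc v x ^ (1 + η) = v x * v x ^ η := by
          rw [ENNReal.rpow_add_of_nonneg _ _ zero_le_one hη.le, ENNReal.rpow_one]
      _ ≤ (ENNReal.ofReal θ⁻¹ * w x) * (ENNReal.ofReal θ⁻¹ * min (w x) n) ^ η := by gcongr
      _ = ENNReal.ofReal (θ⁻¹ ^ (1 + η)) * (w x * (min (w x) n) ^ η) := by
          rw [ENNReal.mul_rpow_of_nonneg _ _ hη.le,
            ← ENNReal.ofReal_rpow_of_nonneg (by positivity) (by positivity),
            ENNReal.rpow_add_of_nonneg _ _ zero_le_one hη.le, ENNReal.rpow_one]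
          ring
  calc ∫⁻ x, (min (w x) n) ^ η ∂ν
      = ENNReal.ofReal η * ∫⁻ t in Ioi (0 : ℝ), ν {x | ENNReal.ofReal t < min (w x) n} *
          ENNReal.ofReal (t ^ (η - 1)) :=
        lintegral_ennreal_rpow_eq ν (hν.min aemeasurable_const) (Filter.Eventually.of_forall
          fun x => ((min_le_right _ _).trans_lt ENNReal.coe_lt_top).ne) hη
    _ ≤ ENNReal.ofReal η * ∫⁻ t in Ioi (0 : ℝ),
          (ν {_x | ENNReal.ofReal t < ENNReal.ofReal t₀} * ENNReal.ofReal (t ^ (η - 1)) +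
          C * (μ {x | ENNReal.ofReal t < v x} * ENNReal.ofReal (t ^ (1 + η - 1)))) := by
        gcongr ENNReal.ofReal η * ?_
        refine setLIntegral_mono' measurableSet_Ioi fun t ht => ?_
        have ht : 0 < t := ht
        have e : ENNReal.ofReal (t ^ (1 + η - 1)) =
            ENNReal.ofReal t * ENNReal.ofReal (t ^ (η - 1)) := by
          rw [← ENNReal.ofReal_mul ht.le, show 1 + η - 1 = η by ring, Real.rpow_sub_one ht.ne' η]
          congr 1
          field_simp
        rw [e]
        calc _ ≤ (ν {_x | ENNReal.ofReal t < ENNReal.ofReal t₀} +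
              C * ENNReal.ofReal t * μ {x | ENNReal.ofReal t < v x}) *
              ENNReal.ofReal (t ^ (η - 1)) := by
              gcongr ?_ * _
              exact hpt t ht
          _ = _ := by ring
    _ = ENNReal.ofReal (t₀ ^ η) * ν univ + ENNReal.ofReal η * (C *
          ∫⁻ t in Ioi (0 : ℝ), μ {x | ENNReal.ofReal t < v x} *
            ENNReal.ofReal (t ^ (1 + η - 1))) := by
        have hm : Measurable fun t : ℝ => ν {_x : α | ENNReal.ofReal t < ENNReal.ofReal t₀} := by
          refine Antitone.measurable fun a b hab => measure_mono fun x hx => ?_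
          exact lt_of_le_of_lt (ENNReal.ofReal_le_ofReal hab) hx
        have hm' : Measurable fun t : ℝ => ν {_x : α | ENNReal.ofReal t < ENNReal.ofReal t₀} *
            ENNReal.ofReal (t ^ (η - 1)) := hm.mul (by fun_prop)
        rw [lintegral_add_left hm', mul_add, ← hconst,
          lintegral_const_mul' _ _ (by finiteness)]
    _ ≤ ENNReal.ofReal (t₀ ^ η) * ν univ + ENNReal.ofReal η * (C * ∫⁻ x, v x ^ (1 + η) ∂μ) := by
        gcongr
        rw [hvint]
        refine le_mul_of_one_le_left (zero_le) ?_
        rw [ENNReal.one_le_ofReal]; linarith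
    _ ≤ ENNReal.ofReal (t₀ ^ η) * ν univ + ENNReal.ofReal η * (C * (ENNReal.ofReal (θ⁻¹ ^ (1 + η)) *
          ∫⁻ x, w x * (min (w x) n) ^ η ∂μ)) := by gcongr
    _ = _ := by
        rw [ENNReal.ofReal_mul hη.le]
        ring

/-- An absorption principle for a bounded sequence. -/
lemma le_four_mul_of_le_add_half_mul {I : ℕ → ℝ≥0∞} {A B ρ : ℝ≥0∞} (hB : B ≠ ∞)
    (hIB : ∀ k, I k ≤ B) (hρ1 : 1 ≤ ρ) (hρ : ρ ≤ 3 / 2)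
    (hI : ∀ k, I k ≤ A * ρ ^ k + 2⁻¹ * I (k + 1)) : I 0 ≤ 4 * A := by
  have hρ0 : ρ ≠ 0 := (zero_lt_one.trans_le hρ1).ne'
  have hρt : ρ ≠ ∞ := (hρ.trans_lt (by finiteness)).ne
  -- After division by `ρ ^ k` the recursion reads `S ≤ A + (ρ / 2) S` with `ρ / 2 ≤ 3 / 4`. The
  -- uniform bound `B` makes `S` finite, which is what allows it to be subtracted.
  set S := ⨆ k, I k / ρ ^ k with hS
  have hSB : S ≤ B := iSup_le fun k =>
    ENNReal.div_le_of_le_mul ((hIB k).trans (le_mul_of_one_le_right (zero_le) (one_le_pow₀ hρ1)))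
  have hSt : S ≠ ∞ := (hSB.trans_lt (lt_top_iff_ne_top.2 hB)).ne
  have hS1 : S ≤ A + 3 / 4 * S := by
    refine iSup_le fun k => ENNReal.div_le_of_le_mul ((hI k).trans ?_)
    have h1 : I (k + 1) ≤ S * ρ ^ (k + 1) := by
      rw [← ENNReal.div_le_iff (pow_ne_zero _ hρ0) (by finiteness)]
      exact le_iSup (fun k => I k / ρ ^ k) (k + 1)
    have h2 : (2⁻¹ : ℝ≥0∞) * (3 / 2) = 3 / 4 := by
      rw [show (2⁻¹ : ℝ≥0∞) = ENNReal.ofReal 2⁻¹ by rw [ENNReal.ofReal_inv_of_pos] <;> simp,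
        show (3 / 2 : ℝ≥0∞) = ENNReal.ofReal (3 / 2) by
          rw [ENNReal.ofReal_div_of_pos] <;> simp,
        show (3 / 4 : ℝ≥0∞) = ENNReal.ofReal (3 / 4) by
          rw [ENNReal.ofReal_div_of_pos] <;> simp, ← ENNReal.ofReal_mul (by norm_num)]
      norm_num
    calc A * ρ ^ k + 2⁻¹ * I (k + 1) ≤ A * ρ ^ k + 2⁻¹ * (S * ρ ^ (k + 1)) := by gcongr
      _ = (A + 2⁻¹ * ρ * S) * ρ ^ k := by ring
      _ ≤ (A + 2⁻¹ * (3 / 2) * S) * ρ ^ k := by gcongr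
      _ = _ := by rw [h2]
  have hS2 : S ≤ 4 * A := by
    have h3 : 4 * S ≤ 4 * A + 3 * S := by
      calc 4 * S ≤ 4 * (A + 3 / 4 * S) := by gcongr
        _ = 4 * A + (4 * (3 / 4)) * S := by ring
        _ = _ := by rw [ENNReal.mul_div_cancel (by simp) (by simp)]
    have h4 : S + 3 * S ≤ 4 * A + 3 * S := by
      calc S + 3 * S = 4 * S := by ring
        _ ≤ _ := h3
    exact (ENNReal.add_le_add_iff_right (by finiteness)).1 h4
  refine le_trans ?_ hS2
  simpa using le_iSup (fun k => I k / ρ ^ k) 0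

section

variable {M : Type*} [MetricSpace M] [MeasurableSpace M] {μ : Measure M} {K : ℝ≥0}
  [BorelSpace M] [SecondCountableTopology M]

namespace IsScalarWeight

variable {κ N : ℝ} {w : M → ℝ≥0∞}

/-- One step of the iteration, from radius `R` to `R + ρ`: the level set estimate is used at `s = t
/ K` and inserted in the truncated layer cake formula. Truncation at `n` keeps both sides finite for
the absorption. -/
lemma lintegral_min_rpow_le_add (hw : IsScalarWeight μ κ N w) (h : DoublingWith μ K) (hκ : 0 < κ)
    (hN : 1 ≤ N) (z : M) {R ρ η : ℝ} (hR : 0 < R) (hρ : 0 < ρ) (hη : 0 < η) {t₀ : ℝ} (ht₀ : 0 ≤ t₀)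
    (hsw : ∀ x ∈ ball z R, ∀ k ≤ 3, K * ⨍⁻ y in ball x (ρ / 2 ^ k), w y ∂μ ≤ ENNReal.ofReal t₀)
    (n : ℝ≥0) :
    ∫⁻ x in ball z R, w x * (min (w x) n) ^ η ∂μ ≤
      ENNReal.ofReal (t₀ ^ η) * ∫⁻ x in ball z R, w x ∂μ +
      2 * K ^ 2 * ENNReal.ofReal (η * (2⁻¹ ^ (1 / κ) / (2 * K * N))⁻¹ ^ (1 + η)) *
        ∫⁻ x in ball z (R + ρ), w x * (min (w x) n) ^ η ∂μ := by
  have hK : (0 : ℝ) < K := lt_of_lt_of_le one_pos (by exact_mod_cast h.one_le)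
  have hK1 : (1 : ℝ) ≤ K := by exact_mod_cast h.one_le
  have hN0 : 0 < N := by linarith
  -- The factor `K` comes from `s = t / K`, and the factor 2 turns the non-strict lower level set
  -- into a strict one.
  set θ : ℝ := 2⁻¹ ^ (1 / κ) / (2 * K * N) with hθ
  have hpow1 : (2⁻¹ : ℝ) ^ (1 / κ) ≤ 1 :=
    Real.rpow_le_one (by norm_num) (by norm_num) (by positivity)
  have hθ0 : 0 < θ := by positivity
  have hθ1 : θ ≤ 1 := by
    rw [hθ, div_le_one (by positivity)]
    nlinarith [mul_le_mul hK1 hN zero_le_one hK.le]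
  have hwν : AEMeasurable w ((μ.withDensity w).restrict (ball z R)) :=
    hw.aemeasurable.mono_ac (Measure.absolutelyContinuous_restrict.trans
      (withDensity_absolutelyContinuous _ _))
  have key := lintegral_min_rpow_le (ν := (μ.withDensity w).restrict (ball z R))
    (μ := μ.restrict (ball z (R + ρ))) (C := 2 * K ^ 2) (n := n) (t₀ := t₀)
    hwν hw.aemeasurable.restrict hθ0 hθ1 hη ht₀ (by
      intro t ht htt
      have := hw.withDensity_levelSet_le h hκ hN0 z hR hρ (s := t / K) (by positivity) (by
        intro x hx k hk
        rw [ENNReal.ofReal_div_of_pos hK, ENNReal.le_div_iff_mul_le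
          (Or.inl (by simpa using hK.ne')) (by simp), mul_comm, ENNReal.ofReal_coe_nnreal]
        exact (hsw x hx k hk).trans (ENNReal.ofReal_le_ofReal htt))
      have e1 : (K : ℝ≥0∞) * ENNReal.ofReal (t / K) = ENNReal.ofReal t := by
        rw [← ENNReal.ofReal_coe_nnreal (p := K), ← ENNReal.ofReal_mul hK.le]
        congr 1; field_simp
      rw [e1] at this
      refine this.trans ?_
      have e2 : 2 * (K : ℝ≥0∞) ^ 3 * ENNReal.ofReal (t / K) =
          ((2 * K ^ 2 : ℝ≥0) : ℝ≥0∞) * ENNReal.ofReal t := by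
        rw [← e1]; push_cast; ring
      rw [e2]
      gcongr _ * ?_
      refine measure_mono fun x hx => ?_
      refine lt_of_lt_of_le ?_ (show _ ≤ w x from hx)
      refine (ENNReal.ofReal_lt_ofReal_iff (by positivity)).2 ?_
      have : θ * t = (2⁻¹ ^ (1 / κ) / N * (t / K)) / 2 := by
        rw [hθ]; field_simp
      rw [this]
      exact half_lt_self (by positivity))
  have e3 : ∫⁻ x, (min (w x) n) ^ η ∂((μ.withDensity w).restrict (ball z R)) =
      ∫⁻ x in ball z R, w x * (min (w x) n) ^ η ∂μ := by
    rw [restrict_withDensity measurableSet_ball,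
      lintegral_withDensity_eq_lintegral_mul₀ hw.aemeasurable.restrict
        ((hw.aemeasurable.restrict.min aemeasurable_const).pow_const _)]
    rfl
  rw [e3, Measure.restrict_apply_univ, withDensity_apply _ measurableSet_ball] at key
  refine key.trans_eq ?_
  push_cast
  rfl

/-- The exponent gain in the reverse Hölder inequality. -/
def reverseHolderGain (K : ℝ≥0) (κ : ℝ) : ℝ := 2⁻¹ ^ (1 / κ) / (24 * K ^ 3)

lemma reverseHolderGain_pos (hK : 1 ≤ K) (κ : ℝ) : 0 < reverseHolderGain K κ := by
  have hK : (0 : ℝ) < K := lt_of_lt_of_le one_pos (by exact_mod_cast hK)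
  unfold reverseHolderGain
  positivity

lemma reverseHolderGain_mul_le (hK : 1 ≤ K) (hκ : 0 < κ) :
    reverseHolderGain K κ * K ≤ 1 / 24 := by
  have hK1 : (1 : ℝ) ≤ K := by exact_mod_cast hK
  have hpow1 : (2⁻¹ : ℝ) ^ (1 / κ) ≤ 1 :=
    Real.rpow_le_one (by norm_num) (by norm_num) (by positivity)
  unfold reverseHolderGain
  rw [div_mul_eq_mul_div, div_le_div_iff₀ (by positivity) (by norm_num)]
  have : (K : ℝ) ≤ K ^ 3 := le_self_pow₀ hK1 (by norm_num)
  nlinarith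

lemma reverseHolderGain_le_one (hK : 1 ≤ K) (hκ : 0 < κ) : reverseHolderGain K κ ≤ 1 := by
  have hK1 : (1 : ℝ) ≤ K := by exact_mod_cast hK
  have h1 := reverseHolderGain_mul_le hK hκ
  have h2 := reverseHolderGain_pos hK κ
  nlinarith

/-- The gain is tuned for this bound. With `X` the inverse level ratio and `η` the gain over `N`,
one has `η X = 1 / (12 K ^ 2)`, hence `X ^ η ≤ exp (η X) ≤ 3`, and the product is at most `2 K ^ 2 *
3 / (12 K ^ 2) = 1 / 2`. -/
lemma absorption_constant_le (hK : 1 ≤ K) (hN : 1 ≤ N) :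
    2 * (K : ℝ) ^ 2 * (reverseHolderGain K κ / N *
      (2⁻¹ ^ (1 / κ) / (2 * K * N))⁻¹ ^ (1 + reverseHolderGain K κ / N)) ≤ 1 / 2 := by
  have hK1 : (1 : ℝ) ≤ K := by exact_mod_cast hK
  have hK0 : (0 : ℝ) < K := by linarith
  have hN0 : 0 < N := by linarith
  set P : ℝ := 2⁻¹ ^ (1 / κ) with hP
  have hP0 : 0 < P := by positivity
  set c := reverseHolderGain K κ with hc
  have hcP : c = P / (24 * K ^ 3) := rfl
  set X : ℝ := (P / (2 * K * N))⁻¹ with hX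
  have hX0 : 0 < X := by positivity
  have hXe : X ^ (c / N) ≤ 3 := by
    have h1 : X ≤ Real.exp X := by linarith [Real.add_one_le_exp X]
    calc X ^ (c / N) ≤ Real.exp X ^ (c / N) :=
          Real.rpow_le_rpow hX0.le h1 (by rw [hcP]; positivity)
      _ = Real.exp (X * (c / N)) := by rw [← Real.exp_mul]
      _ ≤ Real.exp 1 := by
          refine Real.exp_le_exp.2 ?_
          have : X * (c / N) = 1 / (12 * K ^ 2) := by
            rw [hX, hcP]; field_simp; norm_num
          rw [this, div_le_one (by positivity)]
          nlinarith
      _ ≤ 3 := by linarith [Real.exp_one_lt_d9]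
  rw [Real.rpow_add hX0, Real.rpow_one]
  calc 2 * (K : ℝ) ^ 2 * (c / N * (X * X ^ (c / N))) ≤ 2 * (K : ℝ) ^ 2 * (c / N * (X * 3)) := by
        gcongr
        rw [hcP]; positivity
    _ = 1 / 2 := by
        rw [hX, hcP]; field_simp; norm_num

/-- The weak reverse Hölder inequality on balls, with the sharp dependence of the gain in the
exponent on the characteristic of the weight. -/
theorem reverse_holder (hw : IsScalarWeight μ κ N w) (h : DoublingWith μ K) (hκ : 0 < κ)
    (hN : 1 ≤ N) (z : M) {R : ℝ} (hR : 0 < R) :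
    ⨍⁻ x in ball z R, w x ^ (1 + reverseHolderGain K κ / N) ∂μ ≤
      8 * K * (⨍⁻ x in ball z (2 * R), w x ∂μ) ^ (1 + reverseHolderGain K κ / N) := by
  have hK1 : (1 : ℝ) ≤ K := by exact_mod_cast h.one_le
  have hK0 : (0 : ℝ) < K := by linarith
  have hKe : (1 : ℝ≥0∞) ≤ K := by exact_mod_cast h.one_le
  have hN0 : 0 < N := by linarith
  set η := reverseHolderGain K κ / N with hη_def
  have hη : 0 < η := div_pos (reverseHolderGain_pos h.one_le κ) hN0
  have hηc : η ≤ reverseHolderGain K κ := div_le_self (reverseHolderGain_pos h.one_le κ).le hN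
  set Λ := ⨍⁻ x in ball z (2 * R), w x ∂μ with hΛ
  have hΛt : Λ ≠ ∞ := (hw.setLAverage_lt_top h hκ z (by positivity)).ne
  have hΛB : ∫⁻ x in ball z (2 * R), w x ∂μ = Λ * μ (ball z (2 * R)) := by
    rw [hΛ, setLAverage_eq, ENNReal.div_mul_cancel (h.pos _ _ (by positivity)).ne'
      (h.lt_top _ _).ne]
  set ρ : ℝ≥0∞ := (K : ℝ≥0∞) ^ η with hρ
  have hρ1 : 1 ≤ ρ := ENNReal.one_le_rpow hKe hη
  have hKexp : (K : ℝ) ^ η ≤ Real.exp (1 / 24) := by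
    calc (K : ℝ) ^ η ≤ Real.exp K ^ η :=
          Real.rpow_le_rpow hK0.le (by linarith [Real.add_one_le_exp (K : ℝ)]) hη.le
      _ = Real.exp (K * η) := by rw [← Real.exp_mul]
      _ ≤ _ := by
          refine Real.exp_le_exp.2 ?_
          have := reverseHolderGain_mul_le h.one_le hκ
          nlinarith
  have hρK : ρ = ENNReal.ofReal ((K : ℝ) ^ η) := by
    rw [hρ, ← ENNReal.ofReal_rpow_of_pos hK0, ENNReal.ofReal_coe_nnreal]
  have hexp24 : Real.exp (1 / 24) ≤ 24 / 23 := by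
    have := Real.exp_bound_div_one_sub_of_interval (x := 1 / 24) (by norm_num) (by norm_num)
    norm_num at this ⊢
    exact this
  have hρ2 : ρ ≤ 3 / 2 := by
    rw [hρK, show (3 / 2 : ℝ≥0∞) = ENNReal.ofReal (3 / 2) by
          rw [ENNReal.ofReal_div_of_pos] <;> simp]
    exact ENNReal.ofReal_le_ofReal (by linarith)
  have hρ7 : ρ ^ 7 ≤ 2 := by
    rw [hρK, ← ENNReal.ofReal_pow (by positivity), show (2 : ℝ≥0∞) = ENNReal.ofReal 2 by simp]
    refine ENNReal.ofReal_le_ofReal ?_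
    calc ((K : ℝ) ^ η) ^ 7 ≤ (24 / 23) ^ 7 := by gcongr; linarith
      _ ≤ 2 := by norm_num
  have trunc : ∀ n : ℝ≥0, ∫⁻ x in ball z R, w x * (min (w x) n) ^ η ∂μ ≤
      8 * Λ ^ (1 + η) * μ (ball z (2 * R)) := by
    intro n
    -- Radii increasing from `R` towards `2 R`. The gaps halve at each step, so the stopping level
    -- grows by a factor `K` per step, and its power `η` only by `ρ = K ^ η`, which is close to 1.
    set rad : ℕ → ℝ := fun k => R * (2 - (1 / 2) ^ k) with hrad
    have hrad_pos : ∀ k, 0 < rad k := by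
      intro k
      have : ((1 : ℝ) / 2) ^ k ≤ 1 := pow_le_one₀ (by norm_num) (by norm_num)
      simp only [hrad]
      nlinarith
    have hrad_lt : ∀ k, rad k ≤ 2 * R := by
      intro k
      have : (0 : ℝ) < (1 / 2) ^ k := by positivity
      simp only [hrad]
      nlinarith
    set I : ℕ → ℝ≥0∞ := fun k => ∫⁻ x in ball z (rad k), w x * (min (w x) n) ^ η ∂μ with hI
    have hIB : ∀ k, I k ≤ (n : ℝ≥0∞) ^ η * (Λ * μ (ball z (2 * R))) := by
      intro k
      calc I k ≤ ∫⁻ x in ball z (rad k), (n : ℝ≥0∞) ^ η * w x ∂μ := by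
            refine lintegral_mono fun x => ?_
            rw [mul_comm]
            gcongr
            exact min_le_right _ _
        _ ≤ ∫⁻ x in ball z (2 * R), (n : ℝ≥0∞) ^ η * w x ∂μ :=
            lintegral_mono_set (ball_subset_ball (hrad_lt k))
        _ = _ := by rw [lintegral_const_mul' _ _ (by finiteness), hΛB]
    have step : ∀ k, I k ≤ (2 * Λ ^ (1 + η) * μ (ball z (2 * R))) * ρ ^ k + 2⁻¹ * I (k + 1) := by
      intro k
      have hgap : 0 < R * (1 / 2) ^ (k + 1) := by positivity
      have := hw.lintegral_min_rpow_le_add h hκ hN z (hrad_pos k) hgap hη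
        -- `K ^ (k + 6)` compares `ball z (2 * R)` with a ball of radius at least `R 2 ^ (-(k + 4))`
        -- inside it; one more `K` is demanded by the single-step estimate.
        (t₀ := ((K : ℝ≥0∞) ^ (k + 7) * Λ).toReal) ENNReal.toReal_nonneg (by
          intro x hx j hj
          rw [ENNReal.ofReal_toReal (by finiteness)]
          have hb : 0 < R * (1 / 2) ^ (k + 1) / 2 ^ j := by positivity
          have hdist := mem_ball.1 hx
          have hle2 := hrad_lt k
          have hmeas : μ (ball z (2 * R)) ≤ (K : ℝ≥0∞) ^ (k + 6) *
              μ (ball x (R * (1 / 2) ^ (k + 1) / 2 ^ j)) := by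
            refine h.measure_ball_le hb (k + 6) ?_
            rw [dist_comm]
            have hj2 : (2 : ℝ) ^ j ≤ 2 ^ 3 := pow_le_pow_right₀ one_le_two hj
            have e : (2 : ℝ) ^ (k + 6) * (R * (1 / 2) ^ (k + 1) / 2 ^ j) = 32 * R / 2 ^ j := by
              rw [one_div, inv_pow, pow_add, pow_add]
              field_simp
              norm_num
            rw [e, le_div_iff₀ (by positivity)]
            calc (dist x z + 2 * R) * 2 ^ j ≤ (4 * R) * 2 ^ 3 := by gcongr; linarith
              _ = 32 * R := by ring
          have hsub : ball x (R * (1 / 2) ^ (k + 1) / 2 ^ j) ⊆ ball z (2 * R) := by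
            refine ball_subset_ball' ?_
            have h1 : R * (1 / 2) ^ (k + 1) / 2 ^ j ≤ R * (1 / 2) ^ (k + 1) :=
              div_le_self hgap.le (one_le_pow₀ one_le_two)
            have h2 : rad k + R * (1 / 2) ^ (k + 1) = rad (k + 1) := by
              simp only [hrad, pow_succ]; ring
            linarith [hrad_lt (k + 1)]
          have hav : ⨍⁻ y in ball x (R * (1 / 2) ^ (k + 1) / 2 ^ j), w y ∂μ ≤
              (K : ℝ≥0∞) ^ (k + 6) * Λ := by
            rw [setLAverage_eq]
            refine ENNReal.div_le_of_le_mul ?_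
            calc _ ≤ ∫⁻ y in ball z (2 * R), w y ∂μ := lintegral_mono_set hsub
              _ = Λ * μ (ball z (2 * R)) := hΛB
              _ ≤ Λ * ((K : ℝ≥0∞) ^ (k + 6) * μ (ball x (R * (1 / 2) ^ (k + 1) / 2 ^ j))) := by
                gcongr
              _ = _ := by ring
          calc _ ≤ (K : ℝ≥0∞) * ((K : ℝ≥0∞) ^ (k + 6) * Λ) := by gcongr
            _ = _ := by ring) n
      have hrad_succ : rad k + R * (1 / 2) ^ (k + 1) = rad (k + 1) := by
        simp only [hrad, pow_succ]; ring
      rw [hrad_succ] at this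
      refine this.trans (add_le_add ?_ ?_)
      · rw [← ENNReal.ofReal_rpow_of_nonneg ENNReal.toReal_nonneg hη.le,
          ENNReal.ofReal_toReal (by finiteness), ENNReal.mul_rpow_of_nonneg _ _ hη.le]
        have e1 : ((K : ℝ≥0∞) ^ (k + 7)) ^ η = ρ ^ (k + 7) := by
          rw [hρ, ← ENNReal.rpow_natCast, ← ENNReal.rpow_natCast, ← ENNReal.rpow_mul,
            ← ENNReal.rpow_mul, mul_comm]
        calc ((K : ℝ≥0∞) ^ (k + 7)) ^ η * Λ ^ η * ∫⁻ x in ball z (rad k), w x ∂μ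
            ≤ ρ ^ (k + 7) * Λ ^ η * (Λ * μ (ball z (2 * R))) := by
              rw [e1, ← hΛB]
              gcongr
              exact hrad_lt k
          _ = ρ ^ 7 * Λ ^ (1 + η) * μ (ball z (2 * R)) * ρ ^ k := by
              rw [ENNReal.rpow_add_of_nonneg _ _ zero_le_one hη.le, ENNReal.rpow_one, pow_add]
              ring
          _ ≤ _ := by gcongr
      · gcongr ?_ * _
        have := absorption_constant_le (N := N) (κ := κ) h.one_le hN
        rw [← hη_def] at this
        calc 2 * (K : ℝ≥0∞) ^ 2 * ENNReal.ofReal (η * (2⁻¹ ^ (1 / κ) / (2 * K * N))⁻¹ ^ (1 + η))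
            = ENNReal.ofReal (2 * K ^ 2 * (η * (2⁻¹ ^ (1 / κ) / (2 * K * N))⁻¹ ^ (1 + η))) := by
              rw [ENNReal.ofReal_mul (p := 2 * (K : ℝ) ^ 2) (by positivity),
                ENNReal.ofReal_mul (p := 2) (by positivity), ENNReal.ofReal_pow hK0.le,
                ENNReal.ofReal_coe_nnreal]
              simp
          _ ≤ ENNReal.ofReal (1 / 2) := ENNReal.ofReal_le_ofReal this
          _ = 2⁻¹ := by rw [one_div, ENNReal.ofReal_inv_of_pos two_pos]; simp
    have hfin : (n : ℝ≥0∞) ^ η * (Λ * μ (ball z (2 * R))) ≠ ∞ := by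
      have := (h.lt_top z (2 * R)).ne
      have h2 : (n : ℝ≥0∞) ^ η ≠ ∞ := ENNReal.rpow_ne_top_of_nonneg hη.le (by simp)
      finiteness
    have final := le_four_mul_of_le_add_half_mul hfin hIB hρ1 hρ2 step
    have hI0 : I 0 = ∫⁻ x in ball z R, w x * (min (w x) n) ^ η ∂μ := by
      simp only [hI, hrad, pow_zero]
      rw [show R * (2 - 1) = R by ring]
    rw [hI0] at final
    refine final.trans_eq ?_
    ring
  -- The bound does not depend on the truncation height, which is removed by monotone convergence.
  have hlim : ∫⁻ x in ball z R, w x ^ (1 + η) ∂μ ≤ 8 * Λ ^ (1 + η) * μ (ball z (2 * R)) := by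
    have hmono : ∀ᵐ x ∂(μ.restrict (ball z R)),
        w x ^ (1 + η) = ⨆ n : ℕ, w x * (min (w x) ((n : ℝ≥0) : ℝ≥0∞)) ^ η := by
      filter_upwards [ae_restrict_of_ae hw.ne_top] with x hx
      refine le_antisymm ?_ (iSup_le fun n => ?_)
      · obtain ⟨n, hn⟩ := ENNReal.exists_nat_gt hx
        refine le_trans ?_ (le_iSup _ n)
        rw [min_eq_left (by simpa using hn.le), ENNReal.rpow_add_of_nonneg _ _ zero_le_one hη.le,
          ENNReal.rpow_one]
      · rw [ENNReal.rpow_add_of_nonneg _ _ zero_le_one hη.le, ENNReal.rpow_one]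
        gcongr
        exact min_le_left _ _
    have hmeas : ∀ n : ℕ, AEMeasurable (fun x => w x * (min (w x) ((n : ℝ≥0) : ℝ≥0∞)) ^ η)
        (μ.restrict (ball z R)) := fun n => hw.aemeasurable.restrict.mul
      ((hw.aemeasurable.restrict.min aemeasurable_const).pow_const _)
    rw [lintegral_congr_ae hmono, lintegral_iSup' hmeas
      (Filter.Eventually.of_forall fun x m n hmn => by
        dsimp only
        gcongr)]
    exact iSup_le fun n => trunc n
  rw [setLAverage_eq]
  refine ENNReal.div_le_of_le_mul (hlim.trans ?_)
  calc 8 * Λ ^ (1 + η) * μ (ball z (2 * R)) ≤ 8 * Λ ^ (1 + η) * (K * μ (ball z R)) := by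
        gcongr
        exact h.doubling z R hR
    _ = _ := by ring

end IsScalarWeight

end

/-! ### Powers of positive definite matrices and their measurability. -/

section MatrixPowers

variable {d : ℕ} {A : Matrix (Fin d) (Fin d) ℂ}

lemma Matrix.PosDef.spectrum_real_pos (hA : A.PosDef) {x : ℝ} (hx : x ∈ spectrum ℝ A) : 0 < x := by
  obtain ⟨i, rfl⟩ := hA.1.spectrum_real_eq_range_eigenvalues ▸ hx
  exact hA.eigenvalues_pos i

lemma Matrix.continuousOn_real_spectrum (A : Matrix (Fin d) (Fin d) ℂ) (f : ℝ → ℝ) :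
    ContinuousOn f (spectrum ℝ A) := A.finite_real_spectrum.continuousOn f

lemma matPow_isSelfAdjoint (A : Matrix (Fin d) (Fin d) ℂ) (r : ℝ) : IsSelfAdjoint (matPow A r) :=
  cfc_predicate _ A

lemma Matrix.PosDef.matPow_add (hA : A.PosDef) (r s : ℝ) :
    matPow A (r + s) = matPow A r * matPow A s := by
  unfold matPow
  rw [← cfc_mul _ _ A (A.continuousOn_real_spectrum _) (A.continuousOn_real_spectrum _)]
  exact cfc_congr fun x hx => Real.rpow_add (hA.spectrum_real_pos hx) r s

lemma Matrix.PosDef.matPow_zero (hA : A.PosDef) : matPow A 0 = 1 := by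
  have hsa : IsSelfAdjoint A := hA.1
  unfold matPow
  simp only [Real.rpow_zero]
  exact cfc_const_one ℝ A

lemma Matrix.PosDef.matPow_mul_neg (hA : A.PosDef) (r : ℝ) :
    matPow A r * matPow A (-r) = 1 := by
  rw [← hA.matPow_add, add_neg_cancel, hA.matPow_zero]

lemma Matrix.PosDef.matPow_matPow (hA : A.PosDef) (r s : ℝ) :
    matPow (matPow A r) s = matPow A (r * s) := by
  have hsa : IsSelfAdjoint A := hA.1
  unfold matPow
  rw [← cfc_comp (fun x : ℝ => x ^ s) (fun x : ℝ => x ^ r) A hsa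
    ((A.finite_real_spectrum.image _).continuousOn _) (A.continuousOn_real_spectrum _)]
  exact cfc_congr fun x hx => (Real.rpow_mul (hA.spectrum_real_pos hx).le r s).symm

/-- The functional calculus of a Hermitian matrix respects pointwise limits on the spectrum. -/
lemma Matrix.IsHermitian.tendsto_cfc (hA : A.IsHermitian) {F : ℕ → ℝ → ℝ} {f : ℝ → ℝ}
    (h : ∀ x ∈ spectrum ℝ A, Filter.Tendsto (fun n => F n x) Filter.atTop (nhds (f x))) :
    Filter.Tendsto (fun n => _root_.cfc (F n) A) Filter.atTop (nhds (_root_.cfc f A)) := by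
  simp only [hA.cfc_eq, Matrix.IsHermitian.cfc, Unitary.conjStarAlgAut_apply]
  refine (Filter.Tendsto.mul (tendsto_const_nhds.mul ?_) tendsto_const_nhds)
  refine (Continuous.matrix_diagonal continuous_id).tendsto _ |>.comp ?_
  rw [tendsto_pi_nhds]
  intro i
  exact (Complex.continuous_ofReal.tendsto _).comp (h _ (hA.eigenvalues_mem_spectrum_real i))

variable {M : Type*} [MeasurableSpace M] {μ : Measure M} {W : M → Matrix (Fin d) (Fin d) ℂ}

lemma aemeasurable_aeval_matrix (hW : ∀ i j, AEMeasurable (fun x => W x i j) μ)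
    (P : Polynomial ℝ) (i j : Fin d) : AEMeasurable (fun x => (Polynomial.aeval (W x) P) i j) μ := by
  have hpow : ∀ n : ℕ, ∀ i j, AEMeasurable (fun x => (W x ^ n) i j) μ := by
    intro n
    induction n with
    | zero => intro i j; simp only [pow_zero]; exact aemeasurable_const
    | succ n ih =>
      intro i j
      simp only [pow_succ, Matrix.mul_apply]
      exact Finset.aemeasurable_fun_sum _ fun k _ => (ih i k).mul (hW k j)
  simp only [Polynomial.aeval_eq_sum_range, Matrix.sum_apply, Matrix.smul_apply]
  exact Finset.aemeasurable_fun_sum _ fun k _ => (hpow k i j).const_smul (P.coeff k)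

/-- Polynomials in `W` have measurable entries. Weierstrass approximation of `x ^ r` on `[1 / (n +
1), n + 1]` makes the power a pointwise limit of them, since the positive spectrum of each matrix
lies in these intervals eventually. -/
lemma aemeasurable_matPow (hW : ∀ i j, AEMeasurable (fun x => W x i j) μ)
    (hpos : ∀ᵐ x ∂μ, (W x).PosDef) (r : ℝ) (i j : Fin d) :
    AEMeasurable (fun x => matPow (W x) r i j) μ := by
  have hP : ∀ n : ℕ, ∃ P : Polynomial ℝ, ∀ x ∈ Icc ((1 : ℝ) / (n + 1)) (n + 1),
      |P.eval x - x ^ r| < 1 / (n + 1) := by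
    intro n
    refine exists_polynomial_near_of_continuousOn _ _ _ ?_ _ (by positivity)
    refine ContinuousOn.rpow_const continuousOn_id fun x hx => Or.inl ?_
    exact (lt_of_lt_of_le (by positivity) hx.1).ne'
  choose P hP using hP
  refine aemeasurable_of_tendsto_metrizable_ae Filter.atTop
    (fun n => aemeasurable_aeval_matrix hW (P n) i j) ?_
  filter_upwards [hpos] with x hx
  have hsa : IsSelfAdjoint (W x) := hx.1
  have := Matrix.IsHermitian.tendsto_cfc hx.1 (F := fun n => (P n).eval)
    (f := fun y : ℝ => y ^ r) (by
      intro y hy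
      have hy0 := hx.spectrum_real_pos hy
      rw [tendsto_iff_norm_sub_tendsto_zero]
      refine squeeze_zero' (Filter.Eventually.of_forall fun _ => norm_nonneg _) ?_
        tendsto_one_div_add_atTop_nhds_zero_nat
      obtain ⟨m, hm⟩ := exists_nat_gt (max y y⁻¹)
      filter_upwards [Filter.eventually_ge_atTop m] with n hn
      have hmn : (m : ℝ) ≤ n := by exact_mod_cast hn
      refine (hP n y ⟨?_, ?_⟩).le
      · rw [div_le_iff₀ (by positivity), ← div_le_iff₀' hy0, one_div]
        linarith [le_max_right y y⁻¹]
      · linarith [le_max_left y y⁻¹])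
  simp only [cfc_polynomial (R := ℝ) _ (W x) hsa] at this
  exact ((continuous_apply_apply i j).tendsto _).comp this

lemma aestronglyMeasurable_matOp (hW : ∀ i j, AEMeasurable (fun x => W x i j) μ)
    {f : M → EuclideanSpace ℂ (Fin d)} (hf : AEStronglyMeasurable f μ) :
    AEStronglyMeasurable (fun x => matOp (W x) (f x)) μ := by
  have e : ∀ x, matOp (W x) (f x) = ∑ i, (∑ j, W x i j * f x j) • EuclideanSpace.single i (1 : ℂ) := by
    intro x
    ext k
    simp [matOp, Matrix.mulVec, dotProduct, Pi.single_apply]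
  simp only [e]
  refine Finset.aestronglyMeasurable_fun_sum _ fun i _ => ?_
  refine AEStronglyMeasurable.smul_const ?_ _
  refine Finset.aestronglyMeasurable_fun_sum _ fun j _ => ?_
  refine (hW i j).aestronglyMeasurable.mul ?_
  exact (EuclideanSpace.proj (𝕜 := ℂ) j).continuous.comp_aestronglyMeasurable hf

lemma matOp_mul_apply (A B : Matrix (Fin d) (Fin d) ℂ) (v : EuclideanSpace ℂ (Fin d)) :
    matOp (A * B) v = matOp A (matOp B v) := by
  simp [matOp]

lemma matOp_one_apply (v : EuclideanSpace ℂ (Fin d)) : matOp 1 v = v := by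
  simp [matOp]

lemma adjoint_matOp {A : Matrix (Fin d) (Fin d) ℂ} :
    ContinuousLinearMap.adjoint (matOp A) = matOp (star A) := by
  unfold matOp
  rw [map_star]
  rfl

lemma inner_matOp_left {A : Matrix (Fin d) (Fin d) ℂ} (hA : IsSelfAdjoint A)
    (u v : EuclideanSpace ℂ (Fin d)) : inner ℂ (matOp A u) v = inner ℂ u (matOp A v) := by
  rw [← ContinuousLinearMap.adjoint_inner_right, adjoint_matOp, hA.star_eq]

lemma norm_matOp_mul_comm {A B : Matrix (Fin d) (Fin d) ℂ} (hA : IsSelfAdjoint A)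
    (hB : IsSelfAdjoint B) : ‖matOp (A * B)‖ = ‖matOp (B * A)‖ := by
  rw [← LinearIsometryEquiv.norm_map ContinuousLinearMap.adjoint (matOp (A * B)), adjoint_matOp,
    star_mul, hA.star_eq, hB.star_eq]

end MatrixPowers

/-! ### Auerbach bases. -/

section Auerbach

variable {d : ℕ}

lemma Seminorm.continuous_euclideanSpace (ρ : Seminorm ℂ (EuclideanSpace ℂ (Fin d))) :
    Continuous ρ := by
  exact ρ.convexOn.locallyLipschitz.continuous

/-- An Auerbach basis, with its dual basis, of a norm on `ℂ^d`. -/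
theorem exists_auerbach_basis (ρ : Seminorm ℂ (EuclideanSpace ℂ (Fin d)))
    (hρ : ∀ x, ρ x = 0 → x = 0) :
    ∃ e e' : Fin d → EuclideanSpace ℂ (Fin d), (∀ i, ρ (e i) ≤ 1) ∧
      (∀ i x, ‖inner ℂ (e' i) x‖ ≤ ρ x) ∧ ∀ x, x = ∑ i, inner ℂ (e' i) x • e i := by
  have hcont := ρ.continuous_euclideanSpace
  have hcompact : IsCompact {x : EuclideanSpace ℂ (Fin d) | ρ x ≤ 1} := by
    -- The minimum of `ρ` on the Euclidean sphere is positive. In dimension zero the sphere is empty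
    -- and any constant works.
    obtain ⟨c, hc0, hc⟩ : ∃ c : ℝ, 0 < c ∧ ∀ x, c * ‖x‖ ≤ ρ x := by
      have hS : IsCompact (sphere (0 : EuclideanSpace ℂ (Fin d)) 1) := isCompact_sphere _ _
      rcases (sphere (0 : EuclideanSpace ℂ (Fin d)) 1).eq_empty_or_nonempty with h0 | hne
      · refine ⟨1, one_pos, fun x => ?_⟩
        have : x = 0 := by
          by_contra hx
          have : ((‖x‖⁻¹ : ℝ) : ℂ) • x ∈ sphere (0 : EuclideanSpace ℂ (Fin d)) 1 := by
            simp [norm_smul, norm_ne_zero_iff.2 hx]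
          rw [h0] at this
          exact this
        simp [this]
      · obtain ⟨y, hy, hmin⟩ := hS.exists_isMinOn hne hcont.continuousOn
        refine ⟨ρ y, ?_, fun x => ?_⟩
        · refine lt_of_le_of_ne (apply_nonneg ρ y) fun h => ?_
          have := hρ y h.symm
          simp [this] at hy
        · by_cases hx : x = 0
          · simp [hx]
          have hxn : 0 < ‖x‖ := norm_pos_iff.2 hx
          have hmem : ((‖x‖⁻¹ : ℝ) : ℂ) • x ∈ sphere (0 : EuclideanSpace ℂ (Fin d)) 1 := by
            simp [norm_smul, hxn.ne']
          have := hmin hmem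
          simp only [mem_ofPred_eq, map_smul_eq_mul, Complex.norm_real, norm_inv, norm_norm] at this
          rwa [inv_mul_eq_div, le_div_iff₀ hxn] at this
    refine isCompact_of_isClosed_isBounded (isClosed_le hcont continuous_const) ?_
    refine (isBounded_iff_forall_norm_le).2 ⟨c⁻¹, fun x hx => ?_⟩
    rw [← one_div, le_div_iff₀' hc0]
    exact (hc x).trans hx
  set Q : Set (Fin d → EuclideanSpace ℂ (Fin d)) := univ.pi fun _ => {x | ρ x ≤ 1} with hQ
  have hQc : IsCompact Q := isCompact_univ_pi fun _ => hcompact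
  set mat : (Fin d → EuclideanSpace ℂ (Fin d)) → Matrix (Fin d) (Fin d) ℂ :=
    fun x => Matrix.of fun i j => x j i with hmat
  have hdet : Continuous fun x => ‖(mat x).det‖ := by
    refine (Continuous.matrix_det ?_).norm
    refine continuous_matrix fun i j => ?_
    exact (EuclideanSpace.proj (𝕜 := ℂ) i).continuous.comp
      (continuous_apply j)
  -- The basis maximises the volume among tuples in the unit ball of `ρ`. A small multiple of the
  -- standard basis shows that the maximum is not zero.
  obtain ⟨e, heQ, hmax⟩ := hQc.exists_isMaxOn ⟨0, by simp [hQ]⟩ hdet.continuousOn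
  have hA : (mat e).det ≠ 0 := by
    obtain ⟨t, ht0, ht⟩ : ∃ t : ℝ, 0 < t ∧ ∀ j, t * ρ (EuclideanSpace.single j 1) ≤ 1 := by
      refine ⟨(1 + ∑ j, ρ (EuclideanSpace.single j 1))⁻¹, ?_, fun j => ?_⟩
      · have : 0 ≤ ∑ j, ρ (EuclideanSpace.single j (1 : ℂ)) :=
          Finset.sum_nonneg fun j _ => apply_nonneg ρ _
        positivity
      · have h1 : ρ (EuclideanSpace.single j (1 : ℂ)) ≤ ∑ j, ρ (EuclideanSpace.single j (1 : ℂ)) :=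
          Finset.single_le_sum (f := fun j => ρ (EuclideanSpace.single j (1 : ℂ)))
            (fun j _ => apply_nonneg ρ _) (Finset.mem_univ j)
        have h0 := apply_nonneg ρ (EuclideanSpace.single j (1 : ℂ))
        rw [inv_mul_eq_div, div_le_one (by linarith)]
        linarith
    have hmem : (fun j => (t : ℂ) • EuclideanSpace.single j (1 : ℂ)) ∈ Q := by
      intro j _
      simp only [mem_ofPred_eq, map_smul_eq_mul, Complex.norm_real, Real.norm_of_nonneg ht0.le]
      exact ht j
    have hle := hmax hmem
    have hd : mat (fun j => (t : ℂ) • EuclideanSpace.single j (1 : ℂ)) =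
        (t : ℂ) • (1 : Matrix (Fin d) (Fin d) ℂ) := by
      ext i j
      simp [hmat, Matrix.one_apply]
    intro h0
    simp only [mem_ofPred_eq, hd, h0, norm_zero, Matrix.det_smul, Matrix.det_one, mul_one, norm_pow,
      Complex.norm_real, Fintype.card_fin] at hle
    have : 0 < ‖t‖ ^ d := pow_pos (norm_pos_iff.2 ht0.ne') d
    linarith
  have hinv : ∀ i (x : EuclideanSpace ℂ (Fin d)),
      inner ℂ (WithLp.toLp 2 fun j => star ((mat e)⁻¹ i j)) x = ((mat e)⁻¹.mulVec x) i := by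
    intro i x
    simp [PiLp.inner_apply, Matrix.mulVec, dotProduct, mul_comm]
  refine ⟨e, fun i => WithLp.toLp 2 fun j => star ((mat e)⁻¹ i j), fun i => heQ i (mem_univ i),
    fun i x => ?_, fun x => ?_⟩
  · rw [hinv]
    by_cases hx : ρ x = 0
    · simp [hρ x hx]
    have hx0 : 0 < ρ x := lt_of_le_of_ne (apply_nonneg ρ x) (Ne.symm hx)
    -- Replacing the `i`-th vector by `x / ρ x` multiplies the determinant by the `i`-th coordinate
    -- of `x / ρ x` (Cramer's rule). Maximality bounds this coordinate by 1.
    have hmem : update e i ((((ρ x)⁻¹ : ℝ) : ℂ) • x) ∈ Q := by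
      intro j _
      by_cases hj : j = i
      · subst hj
        simp only [update_self, mem_ofPred_eq, map_smul_eq_mul, Complex.norm_real, norm_inv,
          Real.norm_of_nonneg hx0.le, inv_mul_cancel₀ hx, le_refl]
      · rw [update_of_ne hj]; exact heQ j (mem_univ j)
    have hle := hmax hmem
    have hcol : mat (update e i ((((ρ x)⁻¹ : ℝ) : ℂ) • x)) =
        (mat e).updateCol i ((((ρ x)⁻¹ : ℝ) : ℂ) • x.ofLp) := by
      ext k j
      by_cases hj : j = i
      · subst hj
        simp [hmat]
      · simp [hmat, hj]
    have hcr : ((mat e).updateCol i ((((ρ x)⁻¹ : ℝ) : ℂ) • x.ofLp)).det =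
        (((ρ x)⁻¹ : ℝ) : ℂ) * ((mat e).det * ((mat e)⁻¹.mulVec x.ofLp) i) := by
      rw [← Matrix.cramer_apply, map_smul, Matrix.cramer_eq_adjugate_mulVec, Matrix.inv_def,
        Ring.inverse_eq_inv', Matrix.smul_mulVec, Pi.smul_apply, Pi.smul_apply, smul_eq_mul,
        smul_eq_mul, mul_inv_cancel_left₀ hA]
    simp only [mem_ofPred_eq, hcol, hcr, norm_mul, Complex.norm_real, norm_inv,
      Real.norm_of_nonneg hx0.le] at hle
    rw [inv_mul_le_iff₀ hx0, mul_comm (ρ x)] at hle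
    exact le_of_mul_le_mul_left hle (norm_pos_iff.2 hA)
  · ext k
    have : (mat e).mulVec ((mat e)⁻¹.mulVec x) = x := by
      rw [Matrix.mulVec_mulVec, Matrix.mul_nonsing_inv _ (isUnit_iff_ne_zero.2 hA), Matrix.one_mulVec]
    have := congrFun this k
    simp only [hinv]
    simp only [Matrix.mulVec, dotProduct, hmat, Matrix.of_apply] at this
    simp only [WithLp.ofLp_sum, WithLp.ofLp_smul, Finset.sum_apply, Pi.smul_apply, smul_eq_mul]
    rw [← this]
    exact Finset.sum_congr rfl fun i _ => mul_comm _ _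

end Auerbach

/-! ### Weight pairs and the scalar weights they generate. -/

/-- The Muckenhoupt characteristic of a scalar weight is at least one. -/
lemma one_le_lintegral_mul_lintegral_rpow {α : Type*} [MeasurableSpace α] {ν : Measure α}
    [IsProbabilityMeasure ν] {w : α → ℝ≥0∞} (hw : AEMeasurable w ν) (h0 : ∀ᵐ x ∂ν, w x ≠ 0)
    (ht : ∀ᵐ x ∂ν, w x ≠ ∞) {κ : ℝ} (hκ : 0 < κ) :
    1 ≤ (∫⁻ x, w x ∂ν) * (∫⁻ x, w x ^ (-κ) ∂ν) ^ (1 / κ) := by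
  have hκ1 : 0 < 1 + κ := by linarith
  -- Hölder's inequality for `1 = w ^ s * w ^ (-s)` with exponents `(1 + κ) / κ` and `1 + κ`; this
  -- `s` turns the two factors into integrals of `w` and `w ^ (-κ)`.
  set s : ℝ := κ / (1 + κ) with hs
  have hs0 : 0 < s := by positivity
  have hconj : ((1 + κ) / κ).HolderConjugate (1 + κ) := by
    rw [Real.holderConjugate_iff]
    constructor
    · rw [lt_div_iff₀ hκ]; linarith
    · field_simp
      ring
  have hH := ENNReal.lintegral_mul_le_Lp_mul_Lq ν hconj (hw.pow_const s) (hw.pow_const (-s))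
  have h1 : ∫⁻ x, ((fun x => w x ^ s) * fun x => w x ^ (-s)) x ∂ν = 1 := by
    rw [lintegral_congr_ae (g := fun _ => 1)]
    · simp
    · filter_upwards [h0, ht] with x hx0 hxt
      simp [← ENNReal.rpow_add _ _ hx0 hxt]
  have h2 : ∀ x, (w x ^ s) ^ ((1 + κ) / κ) = w x := by
    intro x
    rw [← ENNReal.rpow_mul, hs, show κ / (1 + κ) * ((1 + κ) / κ) = 1 by field_simp,
      ENNReal.rpow_one]
  have h3 : ∀ x, (w x ^ (-s)) ^ (1 + κ) = w x ^ (-κ) := by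
    intro x
    rw [← ENNReal.rpow_mul, hs, show -(κ / (1 + κ)) * (1 + κ) = -κ by field_simp]
  simp only [h1, h2, h3] at hH
  have h4 : 1 ≤ ((∫⁻ x, w x ∂ν) * (∫⁻ x, w x ^ (-κ) ∂ν) ^ (1 / κ)) ^ s := by
    rw [ENNReal.mul_rpow_of_nonneg _ _ hs0.le, ← ENNReal.rpow_mul]
    rwa [show 1 / ((1 + κ) / κ) = s by rw [hs]; field_simp,
      show 1 / (1 + κ) = 1 / κ * s by rw [hs]; field_simp] at hH
  by_contra hlt
  exact absurd h4 (not_le.2 (ENNReal.rpow_lt_one (not_le.1 hlt) hs0))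

/-- The normalised restriction of a measure to a set. -/
abbrev avgMeasure {α : Type*} [MeasurableSpace α] (μ : Measure α) (s : Set α) : Measure α :=
  (μ s)⁻¹ • μ.restrict s

section

variable {M : Type*} [MetricSpace M] [MeasurableSpace M] {μ : Measure M} {K : ℝ≥0} {d : ℕ}

omit [MetricSpace M] in
lemma avgMeasure_absolutelyContinuous (μ : Measure M) (s : Set M) : avgMeasure μ s ≪ μ :=
  (Measure.smul_absolutelyContinuous).trans Measure.absolutelyContinuous_restrict

lemma DoublingWith.isProbabilityMeasure_avgMeasure (h : DoublingWith μ K) (z : M) {r : ℝ}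
    (hr : 0 < r) : IsProbabilityMeasure (avgMeasure μ (ball z r)) :=
  ⟨by simp [avgMeasure, ENNReal.inv_mul_cancel (h.pos z r hr).ne' (h.lt_top z r).ne]⟩

lemma IsScalarWeight.one_le [Nonempty M] {κ N : ℝ} {w : M → ℝ≥0∞} (hw : IsScalarWeight μ κ N w)
    (h : DoublingWith μ K) (hκ : 0 < κ) : 1 ≤ N := by
  obtain ⟨z⟩ := ‹Nonempty M›
  have hac := avgMeasure_absolutelyContinuous μ (ball z 1)
  have := h.isProbabilityMeasure_avgMeasure z one_pos
  have h1 := one_le_lintegral_mul_lintegral_rpow (hw.aemeasurable.mono_ac hac)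
    (hac.ae_le hw.ne_zero) (hac.ae_le hw.ne_top) hκ
  have h2 := hw.le z 1 one_pos
  rw [setLAverage_eq', setLAverage_eq'] at h2
  exact ENNReal.one_le_ofReal.1 (h1.trans h2)

/-- A pair of mutually inverse measurable fields of Hermitian matrices with a two-exponent
Muckenhoupt condition. -/
structure IsWeightPair (μ : Measure M) (a b N : ℝ) (V U : M → Matrix (Fin d) (Fin d) ℂ) :
    Prop where
  aemeasurable_left : ∀ i j, AEMeasurable (fun x => V x i j) μ
  aemeasurable_right : ∀ i j, AEMeasurable (fun x => U x i j) μ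
  selfAdjoint_left : ∀ x, IsSelfAdjoint (V x)
  selfAdjoint_right : ∀ x, IsSelfAdjoint (U x)
  mul_eq_one : ∀ᵐ x ∂μ, V x * U x = 1
  le : ∀ z r, 0 < r → ⨍⁻ x in ball z r,
    (⨍⁻ y in ball z r, ‖matOp (V x * U y)‖ₑ ^ a ∂μ) ^ (b / a) ∂μ ≤ ENNReal.ofReal N

lemma enorm_matOp_apply_le (A : Matrix (Fin d) (Fin d) ℂ) (v : EuclideanSpace ℂ (Fin d)) :
    ‖matOp A v‖ₑ ≤ ‖matOp A‖ₑ * ‖v‖ₑ := (matOp A).le_opENorm v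

lemma enorm_matOp_le_of_mul_eq_one {A B C : Matrix (Fin d) (Fin d) ℂ} (h : B * C = 1)
    (e : EuclideanSpace ℂ (Fin d)) : ‖matOp A e‖ₑ ≤ ‖matOp (A * B)‖ₑ * ‖matOp C e‖ₑ := by
  have : matOp A e = matOp (A * B) (matOp C e) := by
    rw [← matOp_mul_apply, mul_assoc, h, mul_one]
  rw [this]
  exact enorm_matOp_apply_le _ _

namespace IsWeightPair

variable {a b N : ℝ} {V U : M → Matrix (Fin d) (Fin d) ℂ} (hVU : IsWeightPair μ a b N V U)
include hVU

lemma enorm_right_le {x : M} (hx : V x * U x = 1) (y : M) (e : EuclideanSpace ℂ (Fin d)) :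
    ‖matOp (U y) e‖ₑ ≤ ‖matOp (V x * U y)‖ₑ * ‖matOp (U x) e‖ₑ := by
  refine (enorm_matOp_le_of_mul_eq_one hx e).trans ?_
  gcongr
  rw [← ofReal_norm, ← ofReal_norm,
    norm_matOp_mul_comm (hVU.selfAdjoint_left x) (hVU.selfAdjoint_right y)]

/-- From `|V(x)e| ≤ |V(x)U(y)| |V(y)e|`: divide by `|V(y)e|`, average the power `a` in `y`, raise to
`b / a` and average in `x`. -/
lemma isScalarWeight_left (ha : 0 < a) (hb : 0 < b) {e : EuclideanSpace ℂ (Fin d)} (he : e ≠ 0) :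
    IsScalarWeight μ (a / b) N fun x => ‖matOp (V x) e‖ₑ ^ b where
  aemeasurable := (aestronglyMeasurable_matOp hVU.aemeasurable_left
    aestronglyMeasurable_const).enorm.pow_const b
  ne_zero := by
    filter_upwards [hVU.mul_eq_one] with x hx h0
    rw [ENNReal.rpow_eq_zero_iff_of_pos hb, enorm_eq_zero] at h0
    apply he
    rw [← matOp_one_apply e, ← mul_eq_one_comm.1 hx, matOp_mul_apply, h0, map_zero]
  ne_top := Filter.Eventually.of_forall fun x => by finiteness
  le z r hr := by
    refine le_trans ?_ (hVU.le z r hr)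
    rw [setLAverage_eq', setLAverage_eq', setLAverage_eq']
    have hac := avgMeasure_absolutelyContinuous μ (ball z r)
    set ν := avgMeasure μ (ball z r)
    refine (lintegral_mul_const_le _ _).trans (lintegral_mono fun x => ?_)
    rw [setLAverage_eq']
    have e1 : ∀ y, (‖matOp (V y) e‖ₑ ^ b) ^ (-(a / b)) = ‖matOp (V y) e‖ₑ ^ (-a) := by
      intro y
      rw [← ENNReal.rpow_mul]
      congr 1
      field_simp
    simp only [e1]
    have key : ‖matOp (V x) e‖ₑ ^ a * ∫⁻ y, ‖matOp (V y) e‖ₑ ^ (-a) ∂ν ≤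
        ∫⁻ y, ‖matOp (V x * U y)‖ₑ ^ a ∂ν := by
      refine (lintegral_const_mul_le _ _).trans (lintegral_mono_ae ?_)
      filter_upwards [hac.ae_le hVU.mul_eq_one] with y hy
      have h0 : ‖matOp (V y) e‖ₑ ≠ 0 := by
        rw [ne_eq, enorm_eq_zero]
        intro h0
        apply he
        rw [← matOp_one_apply e, ← mul_eq_one_comm.1 hy, matOp_mul_apply, h0, map_zero]
      rw [ENNReal.rpow_neg, ← div_eq_mul_inv]
      refine ENNReal.div_le_of_le_mul ?_
      rw [← ENNReal.mul_rpow_of_nonneg _ _ ha.le]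
      exact ENNReal.rpow_le_rpow (enorm_matOp_le_of_mul_eq_one (mul_eq_one_comm.1 hy) e) ha.le
    have key2 := ENNReal.rpow_le_rpow key (z := b / a) (by positivity)
    rw [ENNReal.mul_rpow_of_nonneg _ _ (by positivity), ← ENNReal.rpow_mul,
      mul_div_cancel₀ _ ha.ne'] at key2
    rwa [one_div_div]

/-- The same argument from `|U(y)e| ≤ |V(x)U(y)| |U(x)e|`, where the two factors may be exchanged
because both are Hermitian. The condition comes out raised to `b / a`, so undoing this power gives
the constant `N ^ (a / b)`. -/
lemma isScalarWeight_right (ha : 0 < a) (hb : 0 < b) (hN : 0 ≤ N)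
    {e : EuclideanSpace ℂ (Fin d)} (he : e ≠ 0) :
    IsScalarWeight μ (b / a) (N ^ (a / b)) fun x => ‖matOp (U x) e‖ₑ ^ a where
  aemeasurable := (aestronglyMeasurable_matOp hVU.aemeasurable_right
    aestronglyMeasurable_const).enorm.pow_const a
  ne_zero := by
    filter_upwards [hVU.mul_eq_one] with x hx h0
    rw [ENNReal.rpow_eq_zero_iff_of_pos ha, enorm_eq_zero] at h0
    apply he
    rw [← matOp_one_apply e, ← hx, matOp_mul_apply, h0, map_zero]
  ne_top := Filter.Eventually.of_forall fun x => by finiteness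
  le z r hr := by
    have hle := hVU.le z r hr
    rw [setLAverage_eq'] at hle
    rw [setLAverage_eq', setLAverage_eq']
    have hac := avgMeasure_absolutelyContinuous μ (ball z r)
    set ν := avgMeasure μ (ball z r)
    have e1 : ∀ y, (‖matOp (U y) e‖ₑ ^ a) ^ (-(b / a)) = ‖matOp (U y) e‖ₑ ^ (-b) := by
      intro y
      rw [← ENNReal.rpow_mul]
      congr 1
      field_simp
    simp only [e1]
    have key : (∫⁻ y, ‖matOp (U y) e‖ₑ ^ a ∂ν) ^ (b / a) * ∫⁻ x, ‖matOp (U x) e‖ₑ ^ (-b) ∂ν ≤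
        ENNReal.ofReal N := by
      refine le_trans ?_ hle
      refine (lintegral_const_mul_le _ _).trans (lintegral_mono_ae ?_)
      filter_upwards [hac.ae_le hVU.mul_eq_one] with x hx
      rw [setLAverage_eq', ENNReal.rpow_neg, ← div_eq_mul_inv]
      refine ENNReal.div_le_of_le_mul ?_
      have h1 : ∫⁻ y, ‖matOp (U y) e‖ₑ ^ a ∂ν ≤
          (∫⁻ y, ‖matOp (V x * U y)‖ₑ ^ a ∂ν) * ‖matOp (U x) e‖ₑ ^ a := by
        rw [← lintegral_mul_const' _ _ (by finiteness)]
        refine lintegral_mono fun y => ?_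
        rw [← ENNReal.mul_rpow_of_nonneg _ _ ha.le]
        exact ENNReal.rpow_le_rpow (hVU.enorm_right_le hx y e) ha.le
      have h2 := ENNReal.rpow_le_rpow h1 (z := b / a) (by positivity)
      rwa [ENNReal.mul_rpow_of_nonneg _ _ (by positivity), ← ENNReal.rpow_mul _ a,
        mul_div_cancel₀ _ ha.ne'] at h2
    have key2 := ENNReal.rpow_le_rpow key (z := a / b) (by positivity)
    rw [ENNReal.mul_rpow_of_nonneg _ _ (by positivity), ← ENNReal.rpow_mul,
      div_mul_div_cancel₀ ha.ne', div_self hb.ne', ENNReal.rpow_one,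
      ENNReal.ofReal_rpow_of_nonneg hN (by positivity)] at key2
    rwa [one_div_div]

lemma lintegral_left_lt_top (h : DoublingWith μ K) (ha : 0 < a) (hb : 0 < b)
    (e : EuclideanSpace ℂ (Fin d)) (z : M) {r : ℝ} (hr : 0 < r) :
    ∫⁻ x in ball z r, ‖matOp (V x) e‖ₑ ^ b ∂μ < ∞ := by
  by_cases he : e = 0
  · simp [he, hb]
  · exact (hVU.isScalarWeight_left ha hb he).setLIntegral_lt_top h (by positivity) z hr

lemma lintegral_right_lt_top (h : DoublingWith μ K) (ha : 0 < a) (hb : 0 < b) (hN : 0 ≤ N)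
    (e : EuclideanSpace ℂ (Fin d)) (z : M) {r : ℝ} (hr : 0 < r) :
    ∫⁻ x in ball z r, ‖matOp (U x) e‖ₑ ^ a ∂μ < ∞ := by
  by_cases he : e = 0
  · simp [he, ha]
  · exact (hVU.isScalarWeight_right ha hb hN he).setLIntegral_lt_top h (by positivity) z hr

end IsWeightPair

/-- The seminorm `e ↦ ‖T e‖_{L^q(ν)}` on vectors. -/
def lpSeminorm (ν : Measure M) (q : ℝ≥0∞) (hq : 1 ≤ q) (T : M → Matrix (Fin d) (Fin d) ℂ)
    (hT : ∀ e, MemLp (fun x => matOp (T x) e) q ν) : Seminorm ℂ (EuclideanSpace ℂ (Fin d)) :=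
  Seminorm.of (fun e => (eLpNorm (fun x => matOp (T x) e) q ν).toReal)
    (fun e₁ e₂ => by
      rw [← ENNReal.toReal_add (hT e₁).2.ne (hT e₂).2.ne]
      refine ENNReal.toReal_mono (ENNReal.add_ne_top.2 ⟨(hT e₁).2.ne, (hT e₂).2.ne⟩) ?_
      simp only [map_add]
      exact eLpNorm_add_le (hT e₁).1 (hT e₂).1 hq)
    (fun c e => by
      simp only [map_smul]
      rw [show (fun x => c • matOp (T x) e) = c • fun x => matOp (T x) e from rfl,
        eLpNorm_const_smul, ENNReal.toReal_mul, toReal_enorm])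

omit [MetricSpace M] in
lemma ofReal_lpSeminorm (ν : Measure M) {q : ℝ} (hq : 1 ≤ q) (T : M → Matrix (Fin d) (Fin d) ℂ)
    (hT : ∀ e, MemLp (fun x => matOp (T x) e) (ENNReal.ofReal q) ν) (e : EuclideanSpace ℂ (Fin d)) :
    ENNReal.ofReal (lpSeminorm ν (ENNReal.ofReal q) (ENNReal.one_le_ofReal.2 hq) T hT e) =
      (∫⁻ x, ‖matOp (T x) e‖ₑ ^ q ∂ν) ^ (1 / q) := by
  have hq0 : 0 < q := by linarith
  change ENNReal.ofReal (eLpNorm (fun x => matOp (T x) e) (ENNReal.ofReal q) ν).toReal = _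
  rw [ENNReal.ofReal_toReal (hT e).2.ne,
    eLpNorm_eq_lintegral_rpow_enorm_toReal (by simpa using hq0) (by simp), ENNReal.toReal_ofReal hq0.le]

lemma memLp_avgMeasure_of_lintegral_lt_top (h : DoublingWith μ K) {q : ℝ} (hq : 0 < q)
    {T : M → Matrix (Fin d) (Fin d) ℂ} (hT : ∀ i j, AEMeasurable (fun x => T x i j) μ)
    (e : EuclideanSpace ℂ (Fin d)) (z : M) {r : ℝ} (hr : 0 < r)
    (hlt : ∫⁻ x in ball z r, ‖matOp (T x) e‖ₑ ^ q ∂μ < ∞) :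
    MemLp (fun x => matOp (T x) e) (ENNReal.ofReal q) (avgMeasure μ (ball z r)) := by
  refine ⟨(aestronglyMeasurable_matOp hT aestronglyMeasurable_const).mono_ac
    (avgMeasure_absolutelyContinuous μ _), ?_⟩
  rw [eLpNorm_eq_lintegral_rpow_enorm_toReal (by simpa using hq) (by simp),
    ENNReal.toReal_ofReal hq.le]
  refine ENNReal.rpow_lt_top_of_nonneg (by positivity) ?_
  rw [avgMeasure, lintegral_smul_measure]
  exact (ENNReal.mul_lt_top (ENNReal.inv_lt_top.2 (h.pos z r hr)) hlt).ne

end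

/-! ### Reducing bases and estimates of single convex body averages. -/

section

variable {M : Type*} [MetricSpace M] [MeasurableSpace M] {μ : Measure M} {K : ℝ≥0} {d : ℕ}

omit [MetricSpace M] in
lemma lpSeminorm_eq_zero {ν : Measure M} [NeZero ν] {q : ℝ≥0∞} (hq : 1 ≤ q)
    {T T' : M → Matrix (Fin d) (Fin d) ℂ} (hT : ∀ e, MemLp (fun x => matOp (T x) e) q ν)
    (hinv : ∀ᵐ x ∂ν, T' x * T x = 1) {e : EuclideanSpace ℂ (Fin d)}
    (he : lpSeminorm ν q hq T hT e = 0) : e = 0 := by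
  change (eLpNorm (fun x => matOp (T x) e) q ν).toReal = 0 at he
  rw [ENNReal.toReal_eq_zero_iff, or_iff_left (hT e).2.ne,
    eLpNorm_eq_zero_iff (hT e).1 (zero_lt_one.trans_le hq).ne'] at he
  obtain ⟨x, hx, hx'⟩ := (he.and hinv).exists
  rw [← matOp_one_apply e, ← hx', matOp_mul_apply]
  simp only [Pi.zero_apply] at hx
  rw [hx, map_zero]

namespace IsWeightPair

variable {a b N : ℝ} {V U : M → Matrix (Fin d) (Fin d) ℂ}

/-- The averaged norm of `U` is controlled by the dual of the averaged norm of `V`. -/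
lemma lintegral_right_rpow_le (hVU : IsWeightPair μ a b N V U) (h : DoublingWith μ K)
    (ha : 1 ≤ a) (hb : 1 ≤ b) (hN : 0 ≤ N) (z : M) {r : ℝ} (hr : 0 < r)
    {ξ : EuclideanSpace ℂ (Fin d)}
    (hξ : ∀ x, ‖inner ℂ ξ x‖ₑ ≤ (⨍⁻ y in ball z r, ‖matOp (V y) x‖ₑ ^ b ∂μ) ^ (1 / b)) :
    (⨍⁻ y in ball z r, ‖matOp (U y) ξ‖ₑ ^ a ∂μ) ^ (1 / a) ≤ d * ENNReal.ofReal N ^ (1 / b) := by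
  have ha0 : 0 < a := by linarith
  have hb0 : 0 < b := by linarith
  have hle := hVU.le z r hr
  simp only [setLAverage_eq'] at hle hξ ⊢
  have hac := avgMeasure_absolutelyContinuous μ (ball z r)
  have hprob := h.isProbabilityMeasure_avgMeasure z hr
  have hT : ∀ e, MemLp (fun x => matOp (U x) e) (ENNReal.ofReal a) (avgMeasure μ (ball z r)) :=
    fun e => memLp_avgMeasure_of_lintegral_lt_top h ha0 hVU.aemeasurable_right e z hr
      (hVU.lintegral_right_lt_top h ha0 hb0 hN e z hr)
  set ν := avgMeasure μ (ball z r)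
  set ρ := lpSeminorm ν (ENNReal.ofReal a) (ENNReal.one_le_ofReal.2 ha) U hT with hρ
  have hρ_eq : ∀ e, ENNReal.ofReal (ρ e) = (∫⁻ y, ‖matOp (U y) e‖ₑ ^ a ∂ν) ^ (1 / a) :=
    fun e => ofReal_lpSeminorm ν ha U hT e
  -- A second Auerbach basis, now for the averaged norm of `U`. Expanding `ξ` in it reduces the
  -- claim to the averaged norms of `V` on the finitely many dual vectors `e' j`, at the cost of the
  -- factor `d`.
  obtain ⟨e, e', he, he', hsum⟩ := exists_auerbach_basis ρ
    (fun x hx => lpSeminorm_eq_zero _ hT (hac.ae_le hVU.mul_eq_one) hx)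
  -- Duality at a fixed `x`: with `η = V(x) e'_j` one has `|η|² = ⟨e'_j, V(x)η⟩ ≤ ρ(V(x)η)`, and
  -- `ρ(V(x)η)` is at most the right-hand side times `|η|`. Averaging the power `b` in `x` then
  -- gives exactly the weight condition.
  have hpt : ∀ j x, ‖matOp (V x) (e' j)‖ₑ ≤ (∫⁻ y, ‖matOp (V x * U y)‖ₑ ^ a ∂ν) ^ (1 / a) := by
    intro j x
    set η := matOp (V x) (e' j) with hη
    by_cases h0 : η = 0
    · simp [h0]
    have h1 : ‖η‖ₑ * ‖η‖ₑ ≤ ENNReal.ofReal (ρ (matOp (V x) η)) := by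
      have h2 := he' j (matOp (V x) η)
      have h3 : inner ℂ (e' j) (matOp (V x) η) = inner ℂ η η := by
        rw [← inner_matOp_left (hVU.selfAdjoint_left x)]
      rw [h3, inner_self_eq_norm_sq_to_K] at h2
      rw [← ofReal_norm, ← ENNReal.ofReal_mul (norm_nonneg _)]
      refine ENNReal.ofReal_le_ofReal (le_trans (le_of_eq ?_) h2)
      simp [sq]
    have h4 : ENNReal.ofReal (ρ (matOp (V x) η)) ≤
        (∫⁻ y, ‖matOp (V x * U y)‖ₑ ^ a ∂ν) ^ (1 / a) * ‖η‖ₑ := by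
      rw [hρ_eq]
      have h5 : ∫⁻ y, ‖matOp (U y) (matOp (V x) η)‖ₑ ^ a ∂ν ≤
          (∫⁻ y, ‖matOp (V x * U y)‖ₑ ^ a ∂ν) * ‖η‖ₑ ^ a := by
        rw [← lintegral_mul_const' _ _ (by finiteness)]
        refine lintegral_mono fun y => ?_
        rw [← ENNReal.mul_rpow_of_nonneg _ _ ha0.le, ← matOp_mul_apply]
        refine ENNReal.rpow_le_rpow ((enorm_matOp_apply_le _ _).trans_eq ?_) ha0.le
        rw [← ofReal_norm (matOp (V x * U y)), ← ofReal_norm (matOp (U y * V x)),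
          norm_matOp_mul_comm (hVU.selfAdjoint_left x) (hVU.selfAdjoint_right y)]
      refine (ENNReal.rpow_le_rpow h5 (by positivity)).trans_eq ?_
      rw [ENNReal.mul_rpow_of_nonneg _ _ (by positivity), ← ENNReal.rpow_mul ‖η‖ₑ,
        mul_one_div_cancel ha0.ne', ENNReal.rpow_one]
    exact (ENNReal.mul_le_mul_iff_left (by simpa using h0) (by finiteness)).1 (h1.trans h4)
  have hV : ∀ j, ‖inner ℂ ξ (e' j)‖ₑ ≤ ENNReal.ofReal N ^ (1 / b) := by
    intro j
    refine (hξ (e' j)).trans (ENNReal.rpow_le_rpow (le_trans ?_ hle) (by positivity))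
    refine lintegral_mono fun x => ?_
    refine (ENNReal.rpow_le_rpow (hpt j x) hb0.le).trans_eq ?_
    rw [← ENNReal.rpow_mul, one_div_mul_eq_div]
  rw [← hρ_eq]
  have h6 : ρ ξ ≤ ∑ j, ‖inner ℂ ξ (e' j)‖ := by
    conv_lhs => rw [hsum ξ]
    refine (Finset.le_sum_of_subadditive ρ (map_zero ρ).le (map_add_le_add ρ) _ _).trans (Finset.sum_le_sum fun j _ => ?_)
    rw [map_smul_eq_mul, norm_inner_symm]
    exact mul_le_of_le_one_right (norm_nonneg _) (he j)
  refine (ENNReal.ofReal_le_ofReal h6).trans ?_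
  rw [ENNReal.ofReal_sum_of_nonneg fun j _ => norm_nonneg _]
  simp only [ofReal_norm]
  refine (Finset.sum_le_sum fun j _ => hV j).trans_eq ?_
  simp

/-- On each ball there is a basis whose elements have averaged norm at most one for `V`, and whose
dual basis has averaged norm controlled by the characteristic for `U`. -/
lemma exists_reducing_basis (hVU : IsWeightPair μ a b N V U) (h : DoublingWith μ K)
    (ha : 1 ≤ a) (hb : 1 ≤ b) (hN : 0 ≤ N) (z : M) {r : ℝ} (hr : 0 < r) :
    ∃ e e' : Fin d → EuclideanSpace ℂ (Fin d),
      (∀ i, (⨍⁻ y in ball z r, ‖matOp (V y) (e i)‖ₑ ^ b ∂μ) ^ (1 / b) ≤ 1) ∧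
      (∀ i, (⨍⁻ y in ball z r, ‖matOp (U y) (e' i)‖ₑ ^ a ∂μ) ^ (1 / a) ≤
        d * ENNReal.ofReal N ^ (1 / b)) ∧
      ∀ x, x = ∑ i, inner ℂ (e' i) x • e i := by
  have ha0 : 0 < a := by linarith
  have hb0 : 0 < b := by linarith
  have hac := avgMeasure_absolutelyContinuous μ (ball z r)
  have hprob := h.isProbabilityMeasure_avgMeasure z hr
  have hT : ∀ e, MemLp (fun x => matOp (V x) e) (ENNReal.ofReal b) (avgMeasure μ (ball z r)) :=
    fun e => memLp_avgMeasure_of_lintegral_lt_top h hb0 hVU.aemeasurable_left e z hr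
      (hVU.lintegral_left_lt_top h ha0 hb0 e z hr)
  obtain ⟨e, e', he, he', hsum⟩ := exists_auerbach_basis
    (lpSeminorm (avgMeasure μ (ball z r)) (ENNReal.ofReal b) (ENNReal.one_le_ofReal.2 hb) V hT)
    (fun x hx => lpSeminorm_eq_zero (T' := U) _ hT (by
      filter_upwards [hac.ae_le hVU.mul_eq_one] with x hx using mul_eq_one_comm.1 hx) hx)
  refine ⟨e, e', fun i => ?_, fun i => ?_, hsum⟩
  · rw [setLAverage_eq', ← ofReal_lpSeminorm _ hb V hT]
    exact ENNReal.ofReal_le_one.2 (he i)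
  · refine hVU.lintegral_right_rpow_le h ha hb hN z hr fun x => ?_
    rw [setLAverage_eq', ← ofReal_lpSeminorm _ hb V hT, ← ofReal_norm]
    exact ENNReal.ofReal_le_ofReal (he' i x)

end IsWeightPair

variable [BorelSpace M] [SecondCountableTopology M]

omit [MetricSpace M] [BorelSpace M] [SecondCountableTopology M] in
/-- Hölder's inequality for the pairing with an element of a convex body average. -/
lemma enorm_inner_le_of_mem_convexBodyAverage {r : ℝ} (hr : 1 ≤ r) {Q : Set M}
    {g : M → EuclideanSpace ℂ (Fin d)} (hg : AEStronglyMeasurable g μ)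
    {v : EuclideanSpace ℂ (Fin d)} (hv : v ∈ convexBodyAverage μ (ENNReal.ofReal r) Q g)
    (e : EuclideanSpace ℂ (Fin d)) :
    ‖inner ℂ e v‖ₑ ≤ (∫⁻ x, ‖inner ℂ e (g x)‖ₑ ^ r ∂(avgMeasure μ Q)) ^ (1 / r) := by
  obtain ⟨φ, hφ, hφ1, rfl⟩ := hv
  have hr0 : 0 < r := by linarith
  have hac := avgMeasure_absolutelyContinuous μ Q
  set ν := avgMeasure μ Q
  -- Without integrability the Bochner integral is zero by convention, and the bound is trivial.
  by_cases hint : Integrable (fun x => φ x • g x) ν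
  swap
  · rw [integral_undef hint]; simp
  have hconj := ENNReal.HolderConjugate.conjExponent (ENNReal.one_le_ofReal.2 hr)
  have hH : ENNReal.HolderTriple (ENNReal.ofReal r).conjExponent (ENNReal.ofReal r) 1 := hconj.symm
  have hk : AEStronglyMeasurable (fun x => inner ℂ e (g x)) ν :=
    (aestronglyMeasurable_const.inner hg).mono_ac hac
  calc ‖inner ℂ e (∫ x, φ x • g x ∂ν)‖ₑ = ‖∫ x, inner ℂ e (φ x • g x) ∂ν‖ₑ := by
        rw [integral_inner hint]
    _ ≤ ∫⁻ x, ‖inner ℂ e (φ x • g x)‖ₑ ∂ν := enorm_integral_le_lintegral_enorm _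
    _ = eLpNorm (φ • fun x => inner ℂ e (g x)) 1 ν := by
        rw [eLpNorm_one_eq_lintegral_enorm]
        refine lintegral_congr fun x => ?_
        rw [inner_smul_right]
        rfl
    _ ≤ eLpNorm φ (ENNReal.ofReal r).conjExponent ν *
          eLpNorm (fun x => inner ℂ e (g x)) (ENNReal.ofReal r) ν :=
        eLpNorm_smul_le_mul_eLpNorm hk hφ.1
    _ ≤ 1 * eLpNorm (fun x => inner ℂ e (g x)) (ENNReal.ofReal r) ν := by gcongr
    _ = _ := by
        rw [one_mul, eLpNorm_eq_lintegral_rpow_enorm_toReal (by simpa using hr0) (by simp),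
          ENNReal.toReal_ofReal hr0.le]

omit [BorelSpace M] [SecondCountableTopology M] in
lemma lintegral_avgMeasure_le (h : DoublingWith μ K) {z : M} {R : ℝ} (hR : 0 < R) {Q : Set M}
    (hQ1 : ball z (R / 4) ⊆ Q) (hQ2 : Q ⊆ ball z R) (f : M → ℝ≥0∞) :
    ∫⁻ x, f x ∂(avgMeasure μ Q) ≤ (K : ℝ≥0∞) ^ 2 * ∫⁻ x, f x ∂(avgMeasure μ (ball z R)) := by
  have h1 : μ (ball z R) ≤ (K : ℝ≥0∞) ^ 2 * μ Q :=
    (h.measure_ball_le (y := z) (s := R / 4) (by positivity) 2 (by rw [dist_self]; linarith)).trans (by gcongr)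
  have hQ0 : μ Q ≠ 0 := ((h.pos z (R / 4) (by positivity)).trans_le (measure_mono hQ1)).ne'
  have hQt : μ Q ≠ ∞ := ((measure_mono hQ2).trans_lt (h.lt_top z R)).ne
  have h2 : (μ Q)⁻¹ ≤ (K : ℝ≥0∞) ^ 2 * (μ (ball z R))⁻¹ := by
    rw [← div_eq_mul_inv, ENNReal.le_div_iff_mul_le (Or.inl (h.pos z R hR).ne')
      (Or.inl (h.lt_top z R).ne), mul_comm, ← div_eq_mul_inv]
    exact ENNReal.div_le_of_le_mul h1
  rw [avgMeasure, avgMeasure, lintegral_smul_measure, lintegral_smul_measure, smul_eq_mul,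
    smul_eq_mul, ← mul_assoc]
  gcongr

/-- The pairing of a vector with a convex body average, estimated by the averaged norm of the
vector and an average with an exponent improved by the reverse Hölder inequality. -/
lemma enorm_inner_le_of_isScalarWeight (h : DoublingWith μ K) {κ N q r r' : ℝ}
    {T T' : M → Matrix (Fin d) (Fin d) ℂ} (hTm : ∀ i j, AEMeasurable (fun x => T x i j) μ)
    (hTm' : ∀ i j, AEMeasurable (fun x => T' x i j) μ) (hsa : ∀ x, IsSelfAdjoint (T x))
    (hinv : ∀ᵐ x ∂μ, T x * T' x = 1) {e : EuclideanSpace ℂ (Fin d)}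
    (hw : IsScalarWeight μ κ N fun x => ‖matOp (T x) e‖ₑ ^ q) (hκ : 0 < κ) (hN : 1 ≤ N)
    (hr : 1 ≤ r) (hrq : r < q)
    (hrr : 1 / r = 1 / (q * (1 + IsScalarWeight.reverseHolderGain K κ / N)) + 1 / r')
    {z : M} {R : ℝ} (hR : 0 < R) {Q : Set M}
    (hQ1 : ball z (R / 4) ⊆ Q) (hQ2 : Q ⊆ ball z R) {g : M → EuclideanSpace ℂ (Fin d)}
    (hg : AEStronglyMeasurable g μ) {v : EuclideanSpace ℂ (Fin d)}
    (hv : v ∈ convexBodyAverage μ (ENNReal.ofReal r) Q g) :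
    ‖inner ℂ e v‖ₑ ≤ 8 * (K : ℝ≥0∞) ^ 3 *
      (⨍⁻ x in ball z (2 * R), ‖matOp (T x) e‖ₑ ^ q ∂μ) ^ (1 / q) *
      (⨍⁻ x in ball z R, ‖matOp (T' x) (g x)‖ₑ ^ r' ∂μ) ^ (1 / r') := by
  have hKe : (1 : ℝ≥0∞) ≤ K := by exact_mod_cast h.one_le
  have hr0 : 0 < r := by linarith
  have hq0 : 0 < q := by linarith
  set η := IsScalarWeight.reverseHolderGain K κ / N with hη
  have hη0 : 0 < η := div_pos (IsScalarWeight.reverseHolderGain_pos h.one_le κ) (by linarith)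
  have hRH := hw.reverse_holder h hκ hN z hR
  rw [← hη] at hRH
  have hac := avgMeasure_absolutelyContinuous μ (ball z R)
  rw [setLAverage_eq'] at hRH
  rw [setLAverage_eq' μ _ (ball z R)]
  set Λ := ⨍⁻ x in ball z (2 * R), ‖matOp (T x) e‖ₑ ^ q ∂μ
  set ν := avgMeasure μ (ball z R)
  have h1 := enorm_inner_le_of_mem_convexBodyAverage hr hg hv e
  have h2 := lintegral_avgMeasure_le h hR hQ1 hQ2 (fun x => ‖inner ℂ e (g x)‖ₑ ^ r)
  have h3 : ∫⁻ x, ‖inner ℂ e (g x)‖ₑ ^ r ∂ν ≤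
      ∫⁻ x, ((fun x => ‖matOp (T x) e‖ₑ) * fun x => ‖matOp (T' x) (g x)‖ₑ) x ^ r ∂ν := by
    refine lintegral_mono_ae ?_
    filter_upwards [hac.ae_le hinv] with x hx
    refine ENNReal.rpow_le_rpow ?_ hr0.le
    have : inner ℂ e (g x) = inner ℂ (matOp (T x) e) (matOp (T' x) (g x)) := by
      rw [inner_matOp_left (hsa x), ← matOp_mul_apply, hx, matOp_one_apply]
    rw [this, Pi.mul_apply, ← ofReal_norm, ← ofReal_norm (matOp (T x) e), ← ofReal_norm,
      ← ENNReal.ofReal_mul (norm_nonneg _)]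
    exact ENNReal.ofReal_le_ofReal (norm_inner_le_norm _ _)
  have h4 := ENNReal.lintegral_Lp_mul_le_Lq_mul_Lr hr0
    (show r < q * (1 + η) by nlinarith) hrr ν
    (f := fun x => ‖matOp (T x) e‖ₑ) (g := fun x => ‖matOp (T' x) (g x)‖ₑ)
    ((aestronglyMeasurable_matOp hTm aestronglyMeasurable_const).enorm.mono_ac hac)
    ((aestronglyMeasurable_matOp hTm' hg).enorm.mono_ac hac)
  -- Reverse Hölder for `|Te|^q` brings the exponent `q (1 + η)` back to `q` on the doubled ball, so
  -- the other Hölder factor needs only the smaller exponent `r'`.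
  have h5 : (∫⁻ x, ‖matOp (T x) e‖ₑ ^ (q * (1 + η)) ∂ν) ^ (1 / (q * (1 + η))) ≤
      8 * K * Λ ^ (1 / q) := by
    simp only [ENNReal.rpow_mul]
    refine (ENNReal.rpow_le_rpow hRH (by positivity)).trans ?_
    rw [ENNReal.mul_rpow_of_nonneg _ _ (by positivity), ← ENNReal.rpow_mul]
    rw [show (1 + η) * (1 / (q * (1 + η))) = 1 / q by field_simp]
    gcongr
    refine (ENNReal.rpow_le_rpow_of_exponent_le (y := 1 / (q * (1 + η))) (z := 1) ?_ ?_).trans_eq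
      (ENNReal.rpow_one _)
    · calc (1 : ℝ≥0∞) = 1 * 1 := (one_mul 1).symm
        _ ≤ 8 * K := by gcongr; norm_num
    · rw [div_le_one (by positivity)]; nlinarith
  have h6 : ((K : ℝ≥0∞) ^ 2) ^ (1 / r) ≤ (K : ℝ≥0∞) ^ 2 := by
    refine (ENNReal.rpow_le_rpow_of_exponent_le (z := 1) (one_le_pow₀ hKe) ?_).trans_eq
      (ENNReal.rpow_one _)
    rw [div_le_one hr0]; exact hr
  calc ‖inner ℂ e v‖ₑ ≤ ((K : ℝ≥0∞) ^ 2 * ∫⁻ x, ((fun x => ‖matOp (T x) e‖ₑ) *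
          fun x => ‖matOp (T' x) (g x)‖ₑ) x ^ r ∂ν) ^ (1 / r) := by
        refine h1.trans (ENNReal.rpow_le_rpow (h2.trans ?_) (by positivity))
        gcongr
    _ ≤ (K : ℝ≥0∞) ^ 2 * ((8 * K * Λ ^ (1 / q)) *
          (∫⁻ x, ‖matOp (T' x) (g x)‖ₑ ^ r' ∂ν) ^ (1 / r')) := by
        rw [ENNReal.mul_rpow_of_nonneg _ _ (by positivity)]
        gcongr
        exact h4.trans (by gcongr)
    _ = _ := by ring

omit [MetricSpace M] [BorelSpace M] [SecondCountableTopology M] in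
/-- A function in a weighted space belongs to the unweighted space of a smaller exponent, locally. -/
lemma memLp_of_lintegral_matOp_lt_top {q r P : ℝ}
    {T T' : M → Matrix (Fin d) (Fin d) ℂ} (hTm : ∀ i j, AEMeasurable (fun x => T x i j) μ)
    (hTm' : ∀ i j, AEMeasurable (fun x => T' x i j) μ) (hsa : ∀ x, IsSelfAdjoint (T x))
    (hinv : ∀ᵐ x ∂μ, T x * T' x = 1) (hr : 1 ≤ r) (hrq : r < q) (hP : 0 < P)
    (hrr : 1 / r = 1 / q + 1 / P) {Q : Set M}
    (hlt : ∀ e, ∫⁻ x in Q, ‖matOp (T x) e‖ₑ ^ q ∂μ < ∞) {g : M → EuclideanSpace ℂ (Fin d)}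
    (hg : AEStronglyMeasurable g μ) (hgP : ∫⁻ x, ‖matOp (T' x) (g x)‖ₑ ^ P ∂μ < ∞) :
    MemLp g (ENNReal.ofReal r) (μ.restrict Q) := by
  have hr0 : 0 < r := by linarith
  have hq0 : 0 < q := by linarith
  have hac : μ.restrict Q ≪ μ := Measure.absolutelyContinuous_restrict
  have hcoord : ∀ i, MemLp (fun x => g x i) (ENNReal.ofReal r) (μ.restrict Q) := by
    intro i
    refine ⟨(EuclideanSpace.proj (𝕜 := ℂ) i).continuous.comp_aestronglyMeasurable
      (hg.mono_ac hac), ?_⟩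
    rw [eLpNorm_eq_lintegral_rpow_enorm_toReal (by simpa using hr0) (by simp),
      ENNReal.toReal_ofReal hr0.le]
    have h4 := ENNReal.lintegral_Lp_mul_le_Lq_mul_Lr hr0 hrq hrr (μ.restrict Q)
      (f := fun x => ‖matOp (T x) (EuclideanSpace.single i 1)‖ₑ)
      (g := fun x => ‖matOp (T' x) (g x)‖ₑ)
      ((aestronglyMeasurable_matOp hTm aestronglyMeasurable_const).enorm.mono_ac hac)
      ((aestronglyMeasurable_matOp hTm' hg).enorm.mono_ac hac)
    refine lt_of_le_of_lt (le_trans (ENNReal.rpow_le_rpow (lintegral_mono_ae ?_) (by positivity)) h4) ?_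
    · filter_upwards [hac.ae_le hinv] with x hx
      refine ENNReal.rpow_le_rpow ?_ hr0.le
      -- Each coordinate is a pairing of a locally `L^q` function with an `L^P` function, so Hölder
      -- places it in `L^r`.
      have : g x i = inner ℂ (matOp (T x) (EuclideanSpace.single i 1)) (matOp (T' x) (g x)) := by
        rw [inner_matOp_left (hsa x), ← matOp_mul_apply, hx, matOp_one_apply, EuclideanSpace.inner_single_left]
        simp
      rw [this, Pi.mul_apply, ← ofReal_norm,
        ← ofReal_norm (matOp (T x) (EuclideanSpace.single i 1)), ← ofReal_norm,
        ← ENNReal.ofReal_mul (norm_nonneg _)]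
      exact ENNReal.ofReal_le_ofReal (norm_inner_le_norm _ _)
    · refine ENNReal.mul_lt_top (ENNReal.rpow_lt_top_of_nonneg (by positivity) (hlt _).ne) ?_
      exact ENNReal.rpow_lt_top_of_nonneg (by positivity)
        ((setLIntegral_le_lintegral _ _).trans_lt hgP).ne
  have hsum : g = fun x => ∑ i, g x i • EuclideanSpace.single i (1 : ℂ) := by
    funext x
    ext k
    simp [Pi.single_apply]
  rw [hsum]
  refine memLp_finsetSum _ fun i _ => ?_
  exact (ContinuousLinearMap.toSpanSingleton ℂ (EuclideanSpace.single i (1 : ℂ))).comp_memLp' (hcoord i)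

end

/-! ### Improved exponents and the sum over a sparse family. -/

section

variable {M : Type*} [MetricSpace M] [MeasurableSpace M] {μ : Measure M} {K : ℝ≥0} {d : ℕ}

/-- The exponent `r'` with `1 / r' = 1 / r - 1 / (q (1 + η))`. -/
def improvedExponent (q r η : ℝ) : ℝ := (1 / r - 1 / (q * (1 + η)))⁻¹

lemma one_div_improvedExponent_sub {q r P η : ℝ} (hq : 0 < q) (hη : 0 < η)
    (hrr : 1 / r = 1 / q + 1 / P) :
    1 / improvedExponent q r η - 1 / P = η / (q * (1 + η)) := by
  have : 0 < 1 + η := by linarith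
  rw [improvedExponent, one_div, inv_inv, hrr]
  field_simp
  ring

lemma improvedExponent_pos {q r P η : ℝ} (hq : 0 < q) (hη : 0 < η) (hP : 0 < P)
    (hrr : 1 / r = 1 / q + 1 / P) : 0 < improvedExponent q r η := by
  have h1 := one_div_improvedExponent_sub hq hη hrr
  have h2 : 0 < η / (q * (1 + η)) := by positivity
  have h3 : 0 < 1 / P := by positivity
  exact one_div_pos.1 (by linarith)

lemma improvedExponent_lt {q r P η : ℝ} (hq : 0 < q) (hη : 0 < η) (hP : 0 < P)
    (hrr : 1 / r = 1 / q + 1 / P) : improvedExponent q r η < P := by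
  have h1 := one_div_improvedExponent_sub hq hη hrr
  have h2 : 0 < η / (q * (1 + η)) := by positivity
  exact (one_div_lt_one_div hP (improvedExponent_pos hq hη hP hrr)).1 (by linarith)

lemma one_le_improvedExponent {q r P η : ℝ} (hq : 0 < q) (hr : 1 ≤ r) (hη : 0 < η) (hP : 0 < P)
    (hrr : 1 / r = 1 / q + 1 / P) : 1 ≤ improvedExponent q r η := by
  have h0 := improvedExponent_pos hq hη hP hrr
  have h1 : 1 / r ≤ 1 := by rw [div_le_one (by linarith)]; exact hr
  have h2 : 1 / improvedExponent q r η = 1 / r - 1 / (q * (1 + η)) := by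
    rw [improvedExponent, one_div, inv_inv]
  have h3 : 0 < 1 / (q * (1 + η)) := by positivity
  rw [← one_div_le_one_div h0 one_pos]
  linarith

/-- The maximal constant at exponent `P / s`, with `s` the improved exponent, is governed by `(1 /
s) / (1 / s - 1 / P)`. The gap in the denominator is `η / (q (1 + η))`, so the loss is linear in `1
/ η`. -/
lemma maximal_constant_le {q r P η : ℝ} (hq : 0 < q) (hr : 1 ≤ r) (hη : 0 < η) (hη1 : η ≤ 1)
    (hP : 0 < P) (hrr : 1 / r = 1 / q + 1 / P) :
    2 ^ (P / improvedExponent q r η) *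
      ((P / improvedExponent q r η) / (P / improvedExponent q r η - 1)) ≤
      2 ^ P * (2 * q / η) := by
  have h0 := improvedExponent_pos hq hη hP hrr
  have hlt := improvedExponent_lt hq hη hP hrr
  have h1 := one_le_improvedExponent hq hr hη hP hrr
  have hsub := one_div_improvedExponent_sub hq hη hrr
  set s := improvedExponent q r η
  have hPs : 1 < P / s := (one_lt_div h0).2 hlt
  have e1 : P / s / (P / s - 1) = (1 / s) / (1 / s - 1 / P) := by
    have : P - s ≠ 0 := by linarith
    have : 1 / s - 1 / P ≠ 0 := by rw [hsub]; positivity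
    rw [div_eq_div_iff (by linarith) this]
    field_simp
  have e2 : (1 / s) / (1 / s - 1 / P) ≤ 2 * q / η := by
    rw [hsub, div_div_eq_mul_div, div_le_div_iff_of_pos_right hη]
    have : 1 / s ≤ 1 := by rw [div_le_one h0]; exact h1
    nlinarith [mul_le_mul this (show q * (1 + η) ≤ 2 * q by nlinarith) (by positivity) zero_le_one]
  have e3 : (2 : ℝ) ^ (P / s) ≤ 2 ^ P :=
    Real.rpow_le_rpow_of_exponent_le one_le_two (div_le_self hP.le h1)
  rw [e1]
  have : 0 ≤ 1 / s / (1 / s - 1 / P) := by rw [hsub]; positivity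
  gcongr

variable [BorelSpace M] [SecondCountableTopology M]

/-- A bilinear estimate for averages over balls attached to a finite sparse family. -/
lemma sum_sparse_mul_average_le (h : DoublingWith μ K) {ι : Type*} (T : Finset ι)
    {P F : ι → Set M} {z : ι → M} {R : ι → ℝ} {ε : ℝ} (hε : 0 < ε) (hR : ∀ i ∈ T, 0 < R i)
    (hFm : ∀ i, MeasurableSet (F i)) (hFd : Pairwise (Disjoint on F))
    (hFB : ∀ i ∈ T, F i ⊆ ball (z i) (R i)) (hFP : ∀ i, ENNReal.ofReal ε * μ (P i) ≤ μ (F i))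
    {X Y : M → ℝ≥0∞} (hX : AEMeasurable X μ) (hY : AEMeasurable Y μ) {p p' s s' : ℝ}
    (hpp : p.HolderConjugate p') (hs : 0 < s) (hsp : s < p) (hs' : 0 < s') (hsp' : s' < p')
    {D D' : ℝ} (hD : 2 ^ (p / s) * ((p / s) / (p / s - 1)) ≤ D)
    (hD' : 2 ^ (p' / s') * ((p' / s') / (p' / s' - 1)) ≤ D') :
    ∑ i ∈ T, μ (P i) * ((⨍⁻ x in ball (z i) (R i), X x ^ s ∂μ) ^ (1 / s) *
        (⨍⁻ x in ball (z i) (R i), Y x ^ s' ∂μ) ^ (1 / s')) ≤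
      (ENNReal.ofReal ε)⁻¹ * ((ENNReal.ofReal D * (K : ℝ≥0∞) ^ 3 * ∫⁻ x, X x ^ p ∂μ) ^ (1 / p) *
        (ENNReal.ofReal D' * (K : ℝ≥0∞) ^ 3 * ∫⁻ x, Y x ^ p' ∂μ) ^ (1 / p')) := by
  have hp0 : 0 < p := by linarith
  have hp0' : 0 < p' := by linarith
  have hε0 : ENNReal.ofReal ε ≠ 0 := by simpa using hε
  have maximal : ∀ {X : M → ℝ≥0∞} {p s D : ℝ}, AEMeasurable X μ → 0 < s → s < p →
      2 ^ (p / s) * ((p / s) / (p / s - 1)) ≤ D →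
      (∫⁻ x, ((⨆ i ∈ T, (ball (z i) (R i)).indicator
        (fun _ => ⨍⁻ y in ball (z i) (R i), X y ^ s ∂μ) x) ^ (1 / s)) ^ p ∂μ) ≤
      ENNReal.ofReal D * (K : ℝ≥0∞) ^ 3 * ∫⁻ x, X x ^ p ∂μ := by
    intro X p s D hX hs hsp hD
    have := lintegral_maximal_rpow_le h T z R hR (hX.pow_const s) ((one_lt_div hs).2 hsp)
    have e1 : ∀ y : ℝ≥0∞, (y ^ (1 / s)) ^ p = y ^ (p / s) := by
      intro y; rw [← ENNReal.rpow_mul, one_div_mul_eq_div]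
    have e2 : ∀ y : ℝ≥0∞, (y ^ s) ^ (p / s) = y ^ p := by
      intro y; rw [← ENNReal.rpow_mul, mul_div_cancel₀ _ hs.ne']
    simp only [e2] at this
    simp only [e1]
    refine this.trans ?_
    gcongr
  set m : M → ℝ≥0∞ := fun x => (⨆ i ∈ T, (ball (z i) (R i)).indicator
        (fun _ => ⨍⁻ y in ball (z i) (R i), X y ^ s ∂μ) x) ^ (1 / s) with hm
  set m' : M → ℝ≥0∞ := fun x => (⨆ i ∈ T, (ball (z i) (R i)).indicator
        (fun _ => ⨍⁻ y in ball (z i) (R i), Y y ^ s' ∂μ) x) ^ (1 / s') with hm'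
  have hm_meas : Measurable m := (Measurable.biSup _ T.countable_toSet fun i _ =>
    measurable_const.indicator measurableSet_ball).pow_const _
  have hm_meas' : Measurable m' := (Measurable.biSup _ T.countable_toSet fun i _ =>
    measurable_const.indicator measurableSet_ball).pow_const _
  -- On `F i`, which lies in the `i`-th ball, both averages are below the maximal functions. Since
  -- the `F i` are disjoint, the integrals over them add up to at most one integral over the space.
  have hterm : ∀ i ∈ T, μ (P i) * ((⨍⁻ x in ball (z i) (R i), X x ^ s ∂μ) ^ (1 / s) *
        (⨍⁻ x in ball (z i) (R i), Y x ^ s' ∂μ) ^ (1 / s')) ≤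
      (ENNReal.ofReal ε)⁻¹ * ∫⁻ x in F i, (m * m') x ∂μ := by
    intro i hi
    have hPF : μ (P i) ≤ (ENNReal.ofReal ε)⁻¹ * μ (F i) := by
      rw [mul_comm, ← div_eq_mul_inv, ENNReal.le_div_iff_mul_le (Or.inl hε0) (by simp), mul_comm]
      exact hFP i
    refine (mul_le_mul_left hPF _).trans ?_
    rw [mul_assoc]
    gcongr
    rw [mul_comm, ← setLIntegral_const]
    refine setLIntegral_mono' (hFm i) fun x hx => ?_
    have hxB := hFB i hi hx
    simp only [Pi.mul_apply, hm, hm']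
    gcongr
    · refine le_iSup₂_of_le i hi ?_
      rw [indicator_of_mem hxB]
    · refine le_iSup₂_of_le i hi ?_
      rw [indicator_of_mem hxB]
  calc _ ≤ ∑ i ∈ T, (ENNReal.ofReal ε)⁻¹ * ∫⁻ x in F i, (m * m') x ∂μ := Finset.sum_le_sum hterm
    _ = (ENNReal.ofReal ε)⁻¹ * ∫⁻ x in ⋃ i ∈ T, F i, (m * m') x ∂μ := by
        rw [← Finset.mul_sum, lintegral_biUnion_finset (fun i _ j _ hij => hFd hij)
          (fun i _ => hFm i)]
    _ ≤ (ENNReal.ofReal ε)⁻¹ * ∫⁻ x, (m * m') x ∂μ := by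
        gcongr
        exact Measure.restrict_le_self
    _ ≤ (ENNReal.ofReal ε)⁻¹ * ((∫⁻ x, m x ^ p ∂μ) ^ (1 / p) *
          (∫⁻ x, m' x ^ p' ∂μ) ^ (1 / p')) := by
        gcongr
        exact ENNReal.lintegral_mul_le_Lp_mul_Lq μ hpp hm_meas.aemeasurable hm_meas'.aemeasurable
    _ ≤ _ := by
        gcongr
        · exact maximal hX hs hsp hD
        · exact maximal hY hs' hsp' hD'

namespace IsWeightPair

open IsScalarWeight

variable {a b N : ℝ} {V U : M → Matrix (Fin d) (Fin d) ℂ}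

/-- The estimate of the product of two convex body averages over a set comparable to a ball. -/
lemma supAbs_minkowskiDot_le (hVU : IsWeightPair μ a b N V U) (h : DoublingWith μ K)
    (ha : 1 ≤ a) (hb : 1 ≤ b) (hN : 1 ≤ N) {p p' p₀ r₀ : ℝ} (hp : 0 < p) (hp' : 0 < p')
    (hp₀ : 1 ≤ p₀) (hr₀ : 1 ≤ r₀) (hpa : 1 / p₀ = 1 / a + 1 / p) (hrb : 1 / r₀ = 1 / b + 1 / p')
    {z : M} {R : ℝ} (hR : 0 < R) {Q : Set M} (hQ1 : ball z (R / 4) ⊆ Q) (hQ2 : Q ⊆ ball z R)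
    {f g : M → EuclideanSpace ℂ (Fin d)} (hf : AEStronglyMeasurable f μ)
    (hg : AEStronglyMeasurable g μ) {s s' : ℝ}
    (hs : s = improvedExponent a p₀ (reverseHolderGain K (b / a) / N ^ (a / b)))
    (hs' : s' = improvedExponent b r₀ (reverseHolderGain K (a / b) / N)) :
    supAbs (minkowskiDot (convexBodyAverage μ (ENNReal.ofReal p₀) Q f)
        (convexBodyAverage μ (ENNReal.ofReal r₀) Q g)) ≤
      (d * (8 * (K : ℝ≥0∞) ^ 3) * (8 * (K : ℝ≥0∞) ^ 3) * d) * ENNReal.ofReal N ^ (1 / b) *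
        ((⨍⁻ x in ball z R, ‖matOp (V x) (f x)‖ₑ ^ s ∂μ) ^ (1 / s) *
        (⨍⁻ x in ball z R, ‖matOp (U x) (g x)‖ₑ ^ s' ∂μ) ^ (1 / s')) := by
  have ha0 : 0 < a := by linarith
  have hb0 : 0 < b := by linarith
  have hN0 : 0 ≤ N := by linarith
  have hlt : ∀ {q r P : ℝ}, 0 < q → 0 < P → 1 ≤ r → 1 / r = 1 / q + 1 / P → r < q := by
    intro q r P hq hP hr hrr
    have : 0 < 1 / P := by positivity
    exact (one_div_lt_one_div hq (by linarith)).1 (by linarith)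
  have hone_div : ∀ q r η : ℝ, 1 / r = 1 / (q * (1 + η)) + 1 / improvedExponent q r η := by
    intro q r η
    rw [improvedExponent, one_div (_⁻¹), inv_inv]
    ring
  have hinv' : ∀ᵐ x ∂μ, U x * V x = 1 := by
    filter_upwards [hVU.mul_eq_one] with x hx using mul_eq_one_comm.1 hx
  -- The basis is taken on the doubled ball because the reverse Hölder inequality has its right-hand
  -- side there.
  obtain ⟨e, e', he, he', hsum⟩ := hVU.exists_reducing_basis h ha hb hN0 z
    (r := 2 * R) (by positivity)
  refine iSup₂_le fun w hw => ?_
  obtain ⟨u, hu, v, hv, rfl⟩ := hw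
  set X := (⨍⁻ x in ball z R, ‖matOp (V x) (f x)‖ₑ ^ s ∂μ) ^ (1 / s)
  set Y := (⨍⁻ x in ball z R, ‖matOp (U x) (g x)‖ₑ ^ s' ∂μ) ^ (1 / s')
  have h1 : ∀ i, ‖inner ℂ (e i) v‖ₑ ≤ 8 * (K : ℝ≥0∞) ^ 3 * Y := by
    intro i
    by_cases h0 : e i = 0
    · simp [h0]
    have := enorm_inner_le_of_isScalarWeight h hVU.aemeasurable_left hVU.aemeasurable_right
      hVU.selfAdjoint_left hVU.mul_eq_one (hVU.isScalarWeight_left ha0 hb0 h0) (by positivity) hN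
      hr₀ (hlt hb0 hp' hr₀ hrb) (hone_div _ _ _) hR hQ1 hQ2 hg hv
    rw [← hs'] at this
    refine this.trans ?_
    gcongr ?_ * _
    exact mul_le_of_le_one_right (zero_le) (he i)
  have h2 : ∀ i, ‖inner ℂ (e' i) u‖ₑ ≤
      8 * (K : ℝ≥0∞) ^ 3 * (d * ENNReal.ofReal N ^ (1 / b)) * X := by
    intro i
    by_cases h0 : e' i = 0
    · simp [h0]
    have := enorm_inner_le_of_isScalarWeight h hVU.aemeasurable_right hVU.aemeasurable_left
      hVU.selfAdjoint_right hinv' (hVU.isScalarWeight_right ha0 hb0 hN0 h0) (by positivity)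
      (Real.one_le_rpow hN (by positivity))
      hp₀ (hlt ha0 hp hp₀ hpa) (hone_div _ _ _) hR hQ1 hQ2 hf hu
    rw [← hs] at this
    refine this.trans ?_
    gcongr
    exact he' i
  calc ‖inner ℂ v u‖ₑ = ‖∑ i, inner ℂ (e' i) u * inner ℂ v (e i)‖ₑ := by
        conv_lhs => rw [hsum u]
        rw [inner_sum]
        simp only [inner_smul_right]
    _ ≤ ∑ i, ‖inner ℂ (e' i) u * inner ℂ v (e i)‖ₑ := enorm_sum_le _ _
    _ ≤ ∑ i : Fin d, (8 * (K : ℝ≥0∞) ^ 3 * (d * ENNReal.ofReal N ^ (1 / b)) * X) *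
          (8 * (K : ℝ≥0∞) ^ 3 * Y) := by
        refine Finset.sum_le_sum fun i _ => ?_
        rw [enorm_mul]
        refine mul_le_mul' (h2 i) ?_
        rw [← ofReal_norm, norm_inner_symm, ofReal_norm]
        exact h1 i
    _ = _ := by
        rw [Finset.sum_const, Finset.card_univ, Fintype.card_fin, nsmul_eq_mul]
        ring

/-- The constant in the estimate of sparse forms. -/
def sparseConst (K : ℝ≥0) (d : ℕ) (a b p p' : ℝ) : ℝ≥0∞ :=
  (d * (8 * (K : ℝ≥0∞) ^ 3) * (8 * (K : ℝ≥0∞) ^ 3) * d) *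
    (ENNReal.ofReal (2 ^ p * (2 * a / reverseHolderGain K (b / a))) * (K : ℝ≥0∞) ^ 3) ^ (1 / p) *
    (ENNReal.ofReal (2 ^ p' * (2 * b / reverseHolderGain K (a / b))) * (K : ℝ≥0∞) ^ 3) ^ (1 / p')

omit [MetricSpace M] [MeasurableSpace M] [BorelSpace M] [SecondCountableTopology M] in
lemma sparseConst_ne_top {a b p p' : ℝ} (hp : 0 < p) (hp' : 0 < p') :
    sparseConst K d a b p p' ≠ ∞ := by
  unfold sparseConst
  refine ENNReal.mul_ne_top (ENNReal.mul_ne_top (by finiteness) ?_) ?_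
  · exact ENNReal.rpow_ne_top_of_nonneg (by positivity) (by finiteness)
  · exact ENNReal.rpow_ne_top_of_nonneg (by positivity) (by finiteness)

/-- The weighted estimate for finite sparse forms of convex body averages. -/
theorem sum_sparse_le (hVU : IsWeightPair μ a b N V U) (h : DoublingWith μ K)
    (ha : 1 ≤ a) (hb : 1 ≤ b) (hN : 1 ≤ N) {p p' p₀ r₀ : ℝ} (hpp : p.HolderConjugate p')
    (hp₀ : 1 ≤ p₀) (hr₀ : 1 ≤ r₀) (hpa : 1 / p₀ = 1 / a + 1 / p) (hrb : 1 / r₀ = 1 / b + 1 / p')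
    {ι : Type*} (T : Finset ι) {P F Q : ι → Set M} {z : ι → M} {R : ι → ℝ} {ε : ℝ} (hε : 0 < ε)
    (hR : ∀ i, 0 < R i) (hFm : ∀ i, MeasurableSet (F i)) (hFd : Pairwise (Disjoint on F))
    (hFB : ∀ i, F i ⊆ ball (z i) (R i)) (hFP : ∀ i, ENNReal.ofReal ε * μ (P i) ≤ μ (F i))
    (hQ1 : ∀ i, ball (z i) (R i / 4) ⊆ Q i) (hQ2 : ∀ i, Q i ⊆ ball (z i) (R i))
    {f g : M → EuclideanSpace ℂ (Fin d)} (hf : AEStronglyMeasurable f μ)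
    (hg : AEStronglyMeasurable g μ) :
    ∑ i ∈ T, μ (P i) * supAbs (minkowskiDot (convexBodyAverage μ (ENNReal.ofReal p₀) (Q i) f)
        (convexBodyAverage μ (ENNReal.ofReal r₀) (Q i) g)) ≤
      (ENNReal.ofReal ε)⁻¹ * sparseConst K d a b p p' *
        ENNReal.ofReal N ^ (1 / b + a / (b * p) + 1 / p') *
        (∫⁻ x, ‖matOp (V x) (f x)‖ₑ ^ p ∂μ) ^ (1 / p) *
        (∫⁻ x, ‖matOp (U x) (g x)‖ₑ ^ p' ∂μ) ^ (1 / p') := by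
  have hp := hpp.pos
  have hp' := hpp.symm.pos
  have ha0 : 0 < a := by linarith
  have hb0 : 0 < b := by linarith
  have hN0 : 0 < N := by linarith
  have hNe : ENNReal.ofReal N ≠ 0 := by simpa using hN0
  have hN1 : 1 ≤ N ^ (a / b) := Real.one_le_rpow hN (by positivity)
  have hγ := reverseHolderGain_pos h.one_le (b / a)
  have hγ' := reverseHolderGain_pos h.one_le (a / b)
  have hγ1 : reverseHolderGain K (b / a) ≤ 1 := reverseHolderGain_le_one h.one_le (by positivity)
  have hγ1' : reverseHolderGain K (a / b) ≤ 1 := reverseHolderGain_le_one h.one_le (by positivity)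
  set γ := reverseHolderGain K (b / a)
  set γ' := reverseHolderGain K (a / b)
  set η := γ / N ^ (a / b) with hη
  set η' := γ' / N with hη'
  have hη0 : 0 < η := by positivity
  have hη0' : 0 < η' := by positivity
  have hη1 : η ≤ 1 := (div_le_self hγ.le hN1).trans hγ1
  have hη1' : η' ≤ 1 := (div_le_self hγ'.le hN).trans hγ1'
  set s := improvedExponent a p₀ η with hs
  set s' := improvedExponent b r₀ η' with hs'
  have sparse := sum_sparse_mul_average_le h T hε (fun i _ => hR i) hFm hFd (fun i _ => hFB i) hFP
    (aestronglyMeasurable_matOp hVU.aemeasurable_left hf).enorm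
    (aestronglyMeasurable_matOp hVU.aemeasurable_right hg).enorm hpp
    (improvedExponent_pos ha0 hη0 hp hpa) (improvedExponent_lt ha0 hη0 hp hpa)
    (improvedExponent_pos hb0 hη0' hp' hrb) (improvedExponent_lt hb0 hη0' hp' hrb)
    (maximal_constant_le ha0 hp₀ hη0 hη1 hp hpa) (maximal_constant_le hb0 hr₀ hη0' hη1' hp' hrb)
  set A : ℝ≥0∞ := d * (8 * (K : ℝ≥0∞) ^ 3) * (8 * (K : ℝ≥0∞) ^ 3) * d with hA
  set X := ∫⁻ x, ‖matOp (V x) (f x)‖ₑ ^ p ∂μ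
  set Y := ∫⁻ x, ‖matOp (U x) (g x)‖ₑ ^ p' ∂μ
  -- The gain for `|Ue|^a` is `γ / N ^ (a / b)`, so the maximal operator acting on `|Vf|`
  -- contributes `N ^ (a / (b p))`; on the dual side the gain `γ' / N` contributes `N ^ (1 / p')`.
  have hfac : (ENNReal.ofReal (2 ^ p * (2 * a / η)) * (K : ℝ≥0∞) ^ 3 * X) ^ (1 / p) =
      (ENNReal.ofReal (2 ^ p * (2 * a / γ)) * (K : ℝ≥0∞) ^ 3) ^ (1 / p) *
        ENNReal.ofReal N ^ (a / (b * p)) * X ^ (1 / p) := by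
    have e1 : 2 ^ p * (2 * a / η) = 2 ^ p * (2 * a / γ) * N ^ (a / b) := by
      rw [hη]; field_simp
    have e2 : ENNReal.ofReal N ^ (a / (b * p)) = (ENNReal.ofReal (N ^ (a / b))) ^ (1 / p) := by
      rw [← ENNReal.ofReal_rpow_of_pos hN0, ← ENNReal.rpow_mul]
      congr 1
      field_simp
    rw [e1, e2, ENNReal.ofReal_mul (by positivity), ← ENNReal.mul_rpow_of_nonneg _ _ (by positivity),
      ← ENNReal.mul_rpow_of_nonneg _ _ (by positivity)]
    congr 1
    ring
  have hfac' : (ENNReal.ofReal (2 ^ p' * (2 * b / η')) * (K : ℝ≥0∞) ^ 3 * Y) ^ (1 / p') =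
      (ENNReal.ofReal (2 ^ p' * (2 * b / γ')) * (K : ℝ≥0∞) ^ 3) ^ (1 / p') *
        ENNReal.ofReal N ^ (1 / p') * Y ^ (1 / p') := by
    have e1 : 2 ^ p' * (2 * b / η') = 2 ^ p' * (2 * b / γ') * N := by
      rw [hη']; field_simp
    rw [e1, ENNReal.ofReal_mul (by positivity), ← ENNReal.mul_rpow_of_nonneg _ _ (by positivity),
      ← ENNReal.mul_rpow_of_nonneg _ _ (by positivity)]
    congr 1
    ring
  rw [hfac, hfac'] at sparse
  calc _ ≤ ∑ i ∈ T, A * ENNReal.ofReal N ^ (1 / b) * (μ (P i) *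
          ((⨍⁻ x in ball (z i) (R i), ‖matOp (V x) (f x)‖ₑ ^ s ∂μ) ^ (1 / s) *
          (⨍⁻ x in ball (z i) (R i), ‖matOp (U x) (g x)‖ₑ ^ s' ∂μ) ^ (1 / s'))) := by
        refine Finset.sum_le_sum fun i _ => ?_
        have := hVU.supAbs_minkowskiDot_le h ha hb hN hp hp' hp₀ hr₀ hpa hrb (hR i) (hQ1 i) (hQ2 i)
          hf hg hs hs'
        refine (mul_le_mul_right this _).trans_eq ?_
        ring
    _ ≤ A * ENNReal.ofReal N ^ (1 / b) * ((ENNReal.ofReal ε)⁻¹ *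
          ((ENNReal.ofReal (2 ^ p * (2 * a / γ)) * (K : ℝ≥0∞) ^ 3) ^ (1 / p) *
            ENNReal.ofReal N ^ (a / (b * p)) * X ^ (1 / p) *
          ((ENNReal.ofReal (2 ^ p' * (2 * b / γ')) * (K : ℝ≥0∞) ^ 3) ^ (1 / p') *
            ENNReal.ofReal N ^ (1 / p') * Y ^ (1 / p')))) := by
        rw [← Finset.mul_sum]
        gcongr
    _ = _ := by
        rw [ENNReal.rpow_add _ _ hNe (by simp), ENNReal.rpow_add _ _ hNe (by simp), sparseConst]
        ring

end IsWeightPair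

end

/-! ### From matrix weights and dyadic cubes to weight pairs and balls. -/

lemma ENNReal.conjExponent_ne_top {q : ℝ≥0∞} (hq : 1 < q) : q.conjExponent ≠ ∞ := by
  have := ENNReal.HolderConjugate.conjExponent hq.le
  exact ((ENNReal.HolderConjugate.lt_top_iff_one_lt q.conjExponent q).2 hq).ne

lemma ENNReal.one_le_toReal_conjExponent {q : ℝ≥0∞} (hq : 1 < q) : 1 ≤ q.conjExponent.toReal := by
  have := ENNReal.toReal_mono (conjExponent_ne_top hq)
    (show 1 ≤ q.conjExponent by rw [conjExponent]; exact le_self_add)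
  simpa using this

/-- Writing the conjugate through `q⁻¹` treats `q = ∞` together with the finite exponents. -/
lemma ENNReal.one_div_toReal_conjExponent {q : ℝ≥0∞} (hq : 1 < q) :
    1 / q.conjExponent.toReal = 1 - (q⁻¹).toReal := by
  have h := ENNReal.HolderConjugate.conjExponent hq.le
  have hq0 : q⁻¹ ≠ ∞ := by simpa using (zero_lt_one.trans hq).ne'
  have hq1 : q.conjExponent⁻¹ ≠ ∞ := by simpa using h.symm.ne_zero
  have := congrArg ENNReal.toReal (ENNReal.HolderConjugate.inv_add_inv_eq_one q q.conjExponent)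
  rw [ENNReal.toReal_add hq0 hq1, ENNReal.toReal_inv q.conjExponent, ENNReal.toReal_one] at this
  rw [one_div]
  linarith

section

variable {M : Type*} [MetricSpace M] [MeasurableSpace M] {μ : Measure M} {d : ℕ}

/-- The powers of a matrix weight of orders `1 / p` and `-1 / p` form a weight pair. -/
lemma IsMatrixWeight.isWeightPair {W : M → Matrix (Fin d) (Fin d) ℂ} (hW : IsMatrixWeight μ W)
    {a b p s : ℝ} (hs : s / b = 1 / p) (ha : a.conjExponent.conjExponent = a)
    (hA : muckenhoupt μ a.conjExponent b (fun x => matPow (W x) s) < ∞) :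
    IsWeightPair μ a b (muckenhoupt μ a.conjExponent b (fun x => matPow (W x) s)).toReal
      (fun x => matPow (W x) (1 / p)) (fun x => matPow (W x) (-(1 / p))) where
  aemeasurable_left := aemeasurable_matPow hW.aemeasurable hW.posDef _
  aemeasurable_right := aemeasurable_matPow hW.aemeasurable hW.posDef _
  selfAdjoint_left _ := matPow_isSelfAdjoint _ _
  selfAdjoint_right _ := matPow_isSelfAdjoint _ _
  mul_eq_one := by
    filter_upwards [hW.posDef] with x hx using hx.matPow_mul_neg _
  le z r hr := by
    rw [ENNReal.ofReal_toReal hA.ne]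
    refine le_trans (le_of_eq ?_) (le_iSup₂_of_le z r (le_iSup_of_le hr le_rfl))
    have hpos : ∀ᵐ x ∂avgMeasure μ (ball z r), (W x).PosDef :=
      (avgMeasure_absolutelyContinuous μ _).ae_le hW.posDef
    rw [ha]
    simp only [setLAverage_eq']
    refine lintegral_congr_ae ?_
    filter_upwards [hpos] with x hx
    congr 1
    refine lintegral_congr_ae ?_
    filter_upwards [hpos] with y hy
    rw [hx.matPow_matPow, hy.matPow_matPow, mul_neg, mul_one_div, hs]

lemma DyadicSystem.ell_pos (D : DyadicSystem μ) (P : D.Cube) : 0 < D.ell P := by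
  have h1 := D.δ_pos
  have h2 := D.c₀_pos.trans_le D.c₀_le
  unfold ell
  positivity

lemma DyadicSystem.center_mem (D : DyadicSystem μ) (P : D.Cube) :
    D.center P.1 P.2 ∈ D.toSet P := by
  have h1 := D.δ_pos
  have h2 := D.c₀_pos
  exact D.inner_ball _ _ (mem_ball_self (by positivity))

lemma DyadicSystem.toSet_subset_ball (D : DyadicSystem μ) (P : D.Cube) :
    D.toSet P ⊆ ball (D.center P.1 P.2) (D.ell P) := D.outer_ball _ _

/-- Here `lam ≥ 2` is used in the form `lam / 2 ≤ lam - 1`. With the next inclusion, the dilate lies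
between a ball and its fourfold enlargement, with ratio independent of `lam`; hence the constant
does not depend on `lam`. -/
lemma DyadicSystem.ball_subset_dilate (D : DyadicSystem μ) {lam : ℝ} (hl : 2 ≤ lam) (P : D.Cube) :
    ball (D.center P.1 P.2) (2 * lam * D.ell P / 4) ⊆ D.dilate lam P := by
  intro x hx
  have := infDist_le_dist_of_mem (x := x) (D.center_mem P)
  have h2 := D.ell_pos P
  rw [mem_ball] at hx
  change infDist x (D.toSet P) ≤ _
  nlinarith

lemma DyadicSystem.dilate_subset_ball (D : DyadicSystem μ) {lam : ℝ} (hl : 2 ≤ lam) (P : D.Cube) :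
    D.dilate lam P ⊆ ball (D.center P.1 P.2) (2 * lam * D.ell P) := by
  intro x hx
  have h2 := D.ell_pos P
  have hx' : infDist x (D.toSet P) < lam * D.ell P := lt_of_le_of_lt hx (by nlinarith)
  obtain ⟨y, hy, hxy⟩ := (infDist_lt_iff ⟨_, D.center_mem P⟩).1 hx'
  have := D.toSet_subset_ball P hy
  rw [mem_ball] at this ⊢
  nlinarith [dist_triangle x y (D.center P.1 P.2)]

/-- The norm of the dual weighted space, as an integral against the inverse power. -/
lemma IsMatrixWeight.weightedNorm_dual_eq {W : M → Matrix (Fin d) (Fin d) ℂ}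
    (hW : IsMatrixWeight μ W) {p p' : ℝ} (hpp : p.HolderConjugate p')
    (g : M → EuclideanSpace ℂ (Fin d)) :
    weightedNorm μ p' (fun x => matPow (W x) (-(1 / (p - 1)))) g =
      (∫⁻ x, ‖matOp (matPow (W x) (-(1 / p))) (g x)‖ₑ ^ p' ∂μ) ^ (1 / p') := by
  unfold weightedNorm
  congr 1
  refine lintegral_congr_ae ?_
  filter_upwards [hW.posDef] with x hx
  have h0 := hpp.ne_zero
  have h1 := hpp.sub_one_ne_zero
  rw [hx.matPow_matPow, show -(1 / (p - 1)) * (1 / p') = -(1 / p) by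
    rw [hpp.conjugate_eq]; field_simp]

lemma lintegral_rpow_lt_top_of_rpow_one_div_lt_top {I : ℝ≥0∞} {p : ℝ} (hp : 0 < p)
    (h : I ^ (1 / p) < ∞) : I < ∞ :=
  (ENNReal.rpow_lt_top_iff_of_pos (by positivity)).1 h

end

end

/-! ### The main theorem. -/

theorem theorem1p3 {M : Type*} [MetricSpace M] [LocallyCompactSpace M]
    [TopologicalSpace.SeparableSpace M] [MeasurableSpace M] [BorelSpace M]
    (μ : Measure M) [IsFiniteMeasureOnCompacts μ] (hμ : μ ≠ 0) (hdoubling : VolumeDoubling μ)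
    (d : ℕ) (hd : 0 < d)
    (p₀ p : ℝ) (q₀ : ℝ≥0∞) (hp₀ : 1 ≤ p₀) (hp₀p : p₀ < p) (hpq₀ : ENNReal.ofReal p < q₀)
    (t s' a b α : ℝ)
    (ht : t = p / p₀)
    (hs' : s' = (q₀ / ENNReal.ofReal p).conjExponent.toReal)
    (ha : a = p / (t - 1))
    (hb : b = s' * p)
    (hα : α = 1 / (s' * (p - p₀)) + 1 / p.conjExponent) :
    ∃ C : ℝ, 0 < C ∧
      ∀ (D : DyadicSystem μ) (lam : ℝ), 2 ≤ lam →
      ∀ ε : ℝ, 0 < ε → ε < 1 →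
      ∀ S : Set D.Cube, IsSparse μ ε (fun P : S => D.toSet P) →
      ∀ W : M → Matrix (Fin d) (Fin d) ℂ, IsMatrixWeight μ W →
      muckenhoupt μ a.conjExponent b (fun x => matPow (W x) s') < ∞ →
      ∀ f g : M → EuclideanSpace ℂ (Fin d),
      MemWeightedLp μ p W f →
      MemWeightedLp μ p.conjExponent (fun x => matPow (W x) (-(1 / (p - 1)))) g →
      (∀ P ∈ S, MemLp f (ENNReal.ofReal p₀) (μ.restrict (D.dilate lam P)) ∧
        MemLp g q₀.conjExponent (μ.restrict (D.dilate lam P))) ∧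
      ∑' P : S, μ (D.toSet P) *
          supAbs (minkowskiDot
            (convexBodyAverage μ (ENNReal.ofReal p₀) (D.dilate lam P) f)
            (convexBodyAverage μ q₀.conjExponent (D.dilate lam P) g))
        ≤ ENNReal.ofReal (C / ε) *
          muckenhoupt μ a.conjExponent b (fun x => matPow (W x) s') ^ α *
          weightedNorm μ p W f *
          weightedNorm μ p.conjExponent (fun x => matPow (W x) (-(1 / (p - 1)))) g := by
  have : SecondCountableTopology M := UniformSpace.secondCountable_of_separable M
  have : Nonempty M := by
    by_contra hM
    rw [not_nonempty_iff] at hM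
    exact hμ μ.eq_zero_of_isEmpty
  obtain ⟨K, hK⟩ := hdoubling.exists_doublingWith hμ
  have hp₀0 : 0 < p₀ := by linarith
  have hp1 : 1 < p := by linarith
  have hp0 : 0 < p := by linarith
  have hpp := Real.HolderConjugate.conjExponent hp1
  have hP0 : ENNReal.ofReal p ≠ 0 := by simpa using hp0
  have hq1 : 1 < q₀ := (ENNReal.one_lt_ofReal.2 hp1).trans hpq₀
  have hqp1 : 1 < q₀ / ENNReal.ofReal p := by
    rwa [ENNReal.lt_div_iff_mul_lt (Or.inl hP0) (Or.inl ENNReal.ofReal_ne_top), one_mul]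
  set p' := p.conjExponent with hp'
  set r₀ := q₀.conjExponent.toReal with hr₀
  have hr₀1 : 1 ≤ r₀ := ENNReal.one_le_toReal_conjExponent hq1
  have hr₀q : q₀.conjExponent = ENNReal.ofReal r₀ :=
    (ENNReal.ofReal_toReal (ENNReal.conjExponent_ne_top hq1)).symm
  have hs1 : 1 ≤ s' := hs' ▸ ENNReal.one_le_toReal_conjExponent hqp1
  have hs0 : 0 < s' := by linarith
  have hb0 : 0 < b := by rw [hb]; positivity
  have hb1 : 1 ≤ b := by rw [hb]; nlinarith
  have hsi : 1 / s' = 1 - p * (q₀⁻¹).toReal := by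
    rw [hs', ENNReal.one_div_toReal_conjExponent hqp1,
      ENNReal.inv_div (Or.inl ENNReal.ofReal_ne_top) (Or.inl hP0), div_eq_mul_inv,
      ENNReal.toReal_mul, ENNReal.toReal_ofReal hp0.le]
  have hrb : 1 / r₀ = 1 / b + 1 / p' := by
    have h1 := hpp.one_sub_inv
    rw [one_div p', ← h1, ENNReal.one_div_toReal_conjExponent hq1, hb,
      show 1 / (s' * p) = 1 / s' * (1 / p) by field_simp, hsi]
    field_simp
    ring
  have ha' : a = p * p₀ / (p - p₀) := by
    rw [ha, ht]
    have : p - p₀ ≠ 0 := by linarith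
    field_simp
  have hpp₀ : 0 < p - p₀ := by linarith
  have ha1 : 1 < a := by
    rw [ha', lt_div_iff₀ hpp₀]
    nlinarith
  have ha0 : 0 < a := by linarith
  have hpa : 1 / p₀ = 1 / a + 1 / p := by
    rw [ha']
    field_simp
    ring
  -- The first two terms combine, since `1 + a / p = p / (p - p₀)` and `b = s' p`.
  have hα' : α = 1 / b + a / (b * p) + 1 / p' := by
    rw [hα, ha', hb]
    field_simp
    ring
  have hac : a.conjExponent.conjExponent = a :=
    (Real.HolderConjugate.conjExponent ha1).symm.conjugate_eq.symm
  have hp₀a : p₀ < a := by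
    have : 1 / a < 1 / p₀ := by rw [hpa]; linarith [one_div_pos.2 hp0]
    exact (one_div_lt_one_div ha0 hp₀0).1 this
  have hr₀b : r₀ < b := by
    have : 1 / b < 1 / r₀ := by rw [hrb]; linarith [one_div_pos.2 hpp.symm.pos]
    exact (one_div_lt_one_div hb0 (by linarith)).1 this
  -- Adding 1 only secures strict positivity.
  refine ⟨(IsWeightPair.sparseConst K d a b p p').toReal + 1, by positivity, ?_⟩
  intro D lam hlam ε hε hε1 S hS W hW hA f g hf hg
  set N := (muckenhoupt μ a.conjExponent b (fun x => matPow (W x) s')).toReal with hN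
  have hVU := hW.isWeightPair (p := p) (by rw [hb]; field_simp) hac hA
  rw [← hN] at hVU
  -- A nonzero vector exists because `d > 0`; the scalar weight it generates has characteristic at
  -- least 1.
  have hN1 : 1 ≤ N := (hVU.isScalarWeight_left ha0 hb0
    (e := EuclideanSpace.single ⟨0, hd⟩ 1) (by simp)).one_le hK (by positivity)
  have hgn := hg.2
  rw [hW.weightedNorm_dual_eq hpp] at hgn ⊢
  have hR : ∀ P : D.Cube, 0 < 2 * lam * D.ell P := fun P => by
    have := D.ell_pos P
    positivity
  constructor
  · intro P hP
    constructor
    · refine memLp_of_lintegral_matOp_lt_top hVU.aemeasurable_right hVU.aemeasurable_left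
        hVU.selfAdjoint_right (hVU.mul_eq_one.mono fun x hx => mul_eq_one_comm.1 hx)
        hp₀ hp₀a hp0 hpa (fun e => ?_) hf.1
        (lintegral_rpow_lt_top_of_rpow_one_div_lt_top hp0 hf.2)
      exact (lintegral_mono_set (D.dilate_subset_ball hlam P)).trans_lt
        (hVU.lintegral_right_lt_top hK ha0 hb0 (by linarith) e _ (hR P))
    · rw [hr₀q]
      refine memLp_of_lintegral_matOp_lt_top hVU.aemeasurable_left hVU.aemeasurable_right
        hVU.selfAdjoint_left hVU.mul_eq_one
        hr₀1 hr₀b hpp.symm.pos hrb (fun e => ?_) hg.1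
        (lintegral_rpow_lt_top_of_rpow_one_div_lt_top hpp.symm.pos hgn)
      exact (lintegral_mono_set (D.dilate_subset_ball hlam P)).trans_lt
        (hVU.lintegral_left_lt_top hK ha0 hb0 e _ (hR P))
  · obtain ⟨-, F, hFm, hFP, hFd, hFμ⟩ := hS
    -- The bound for finite subfamilies is uniform, so the supremum over them gives the full sum.
    rw [ENNReal.tsum_eq_iSup_sum, hr₀q]
    refine iSup_le fun T => ?_
    refine (hVU.sum_sparse_le hK ha1.le hb1 hN1 hpp hp₀ hr₀1 hpa hrb T
      (z := fun P => D.center P.1.1 P.1.2) (R := fun P => 2 * lam * D.ell P) hε (fun P => hR P)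
      hFm hFd (fun P => (hFP P).trans ((D.toSet_subset_ball P).trans (Metric.ball_subset_ball ?_)))
      hFμ (fun P => D.ball_subset_dilate hlam P) (fun P => D.dilate_subset_ball hlam P)
      hf.1 hg.1).trans ?_
    · have := D.ell_pos P
      nlinarith
    · rw [← hα', hN, ENNReal.ofReal_toReal hA.ne, weightedNorm]
      gcongr
      rw [ENNReal.ofReal_div_of_pos hε, div_eq_mul_inv, mul_comm]
      gcongr
      exact (ENNReal.ofReal_toReal (IsWeightPair.sparseConst_ne_top hp0 hpp.symm.pos)).symm.le.trans
        (ENNReal.ofReal_le_ofReal (by linarith))
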